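/- For every sample size $n\ge 1$ let $(d_i,w_i,\varepsilon_i,y_i)_{i\le n}$ be random variables on a probability space (they, their laws and the space may all depend on $n$), where $d_i$, $\varepsilon_i$, $y_i$ are scalar, $w_i\in\mathbb R^{d_w}$ with $d_w\ge 1$ fixed, and $$y_i=d_i\beta+w_i^{\top}\gamma+\varepsilon_i,\qquad \mathbb E[\varepsilon_i]=0,\qquad 1\le i\le n .$$ Write $\mathbf D=(d_i)_{i\le n}$, $\mathbf W=(w_i^\top)_{i\le n}$, $\mathbf X=(\mathbf D,\mathbf W)$, $\mathbf Y=(y_i)_{i\le n}$. Suppose there are constants $K,\delta_1,\delta_2>0$ not depending on $n$ such that, for all $n\ge 1$ (with $o_p$ taken as $n\to\infty$): 1. $d_1,\dots,d_n$ are i.i.d. with mean $\mu_d$ and variance $\sigma_d^2\ge K^{-1}$ (both may depend on $n$); $(d_i)_{i\le n}$ is independent of $(w_i)_{i\le n}$, and $(d_i)_{i\le n}$ is independent of $(\varepsilon_i)_{i\le n}$; $\max_{i\le n}\mathbb E|d_i|^{2+\delta_1}\le K$. 2. $\lambda_{\min}(n^{-1}\sum_{i\le n} w_iw_i^\top)\ge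 K^{-1}+o_p(1)$; $\max_{i\le n}\mathbb E\|w_i\|^2\le K$; the first component of the vectors $w_i$, $i\le n$, is a non-zero constant. 3. $n^{-1}\sum_{i\le n} w_i\varepsilon_i=o_p(1)$; $n^{-1}\sum_{i\le n}\varepsilon_i^2=n^{-1}\sum_{i\le n}\mathbb E[\varepsilon_i^2]+o_p(1)$; $\max_{i\le n}\mathbb E|\varepsilon_i|^{2+\delta_2}\le K$; $n^{-1}\sum_{i\le n}\mathbb E[\varepsilon_i^2]\ge K^{-1}$. Let $(\hat\beta,\hat\gamma^\top)^\top=(\mathbf X^\top\mathbf X)^{-1}\mathbf X^\top\mathbf Y$ be the OLS estimator, $s^2=n^{-1}\|\mathbf Y-\mathbf D\hat\beta-\mathbf W\hat\gamma\|^2$, $\mathbf M_W=\mathbf I_n-\mathbf W(\mathbf W^\top\mathbf W)^{-1}\mathbf W^\top$, $\breve{\mathbf D}=\mathbf M_W\mathbf D$, and $\sigma_\varepsilon^2=n^{-1}\sum_{i\le n}\operatorname{Var}(\varepsilon_i)$. (The matrices that are inverted are invertible with probability tending to one; where a matrix is singular, its inverse is read as zero, and likewise division by zero gives zero.) Then,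 as $n\to\infty$, $$s^2\,(n^{-1}\breve{\mathbf D}^\top\breve{\mathbf D})^{-1}=\frac{\sigma_\varepsilon^2}{\sigma_d^2}+o_p(1)\qquad\text{and}\qquad \frac{\hat\beta-\beta}{\sqrt{s^2(\breve{\mathbf D}^\top\breve{\mathbf D})^{-1}}}\to_d N(0,1).$$ Consequently the textbook homoskedastic formula $s^2(\mathbf X^\top\mathbf X)^{-1}$ is valid for $\beta$: both statements remain true when $(\breve{\mathbf D}^\top\breve{\mathbf D})^{-1}$ is replaced by the top left entry $[(\mathbf X^\top\mathbf X)^{-1}]_{11}$, that is, $n\,s^2[(\mathbf X^\top\mathbf X)^{-1}]_{11}=\sigma_\varepsilon^2/\sigma_d^2+o_p(1)$ and $(\hat\beta-\beta)/\sqrt{s^2[(\mathbf X^\top\mathbf X)^{-1}]_{11}}\to_d N(0,1)$. -/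

import Mathlib

open MeasureTheory ProbabilityTheory Filter Topology Matrix

noncomputable section

namespace OLSArray

/-- `R n = o_p(1)`: the random variables `R n`, each on its own probability space `(Ω n, P n)`,
converge to zero in probability as `n → ∞`. -/
def IsLittleOP {Ω : ℕ → Type*} [∀ n, MeasurableSpace (Ω n)] (P : ∀ n, Measure (Ω n))
    (R : ∀ n, Ω n → ℝ) : Prop :=
  ∀ η : ℝ, 0 < η → Tendsto (fun n => P n {ω | η ≤ |R n ω|}) atTop (𝓝 0)

/-- The smallest eigenvalue of a (symmetric) real matrix. -/
def lambdaMin {ι : Type*} [Fintype ι] [DecidableEq ι] (A : Matrix ι ι ℝ) : ℝ :=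
  sInf (spectrum ℝ A)

variable {n p : ℕ}

/-- The matrix `W` whose `i`-th row is the control vector `w i`. -/
def controlMatrix (w : Fin n → EuclideanSpace ℝ (Fin p)) : Matrix (Fin n) (Fin p) ℝ :=
  Matrix.of fun i j => w i j

/-- The regressor matrix `X = (D, W)`; the column `Sum.inl ()` is the regressor of interest. -/
def designMatrix (d : Fin n → ℝ) (w : Fin n → EuclideanSpace ℝ (Fin p)) :
    Matrix (Fin n) (Unit ⊕ Fin p) ℝ :=
  Matrix.fromCols (Matrix.replicateCol Unit d) (controlMatrix w)

/-- The OLS estimator `(XᵀX)⁻¹ XᵀY` of the whole coefficient vector. -/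
def thetaHat (d : Fin n → ℝ) (w : Fin n → EuclideanSpace ℝ (Fin p)) (y : Fin n → ℝ) :
    Unit ⊕ Fin p → ℝ :=
  ((designMatrix d w)ᵀ * designMatrix d w)⁻¹ *ᵥ ((designMatrix d w)ᵀ *ᵥ y)

/-- The OLS estimator of the coefficient of the regressor of interest. -/
def betaHat (d : Fin n → ℝ) (w : Fin n → EuclideanSpace ℝ (Fin p)) (y : Fin n → ℝ) : ℝ :=
  thetaHat d w y (Sum.inl ())

/-- The OLS estimator of the coefficients of the controls. -/
def gammaHat (d : Fin n → ℝ) (w : Fin n → EuclideanSpace ℝ (Fin p)) (y : Fin n → ℝ) :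
    Fin p → ℝ :=
  fun j => thetaHat d w y (Sum.inr j)

/-- The vector of OLS residuals `Y - D β̂ - W γ̂`. -/
def residual (d : Fin n → ℝ) (w : Fin n → EuclideanSpace ℝ (Fin p)) (y : Fin n → ℝ) :
    Fin n → ℝ :=
  y - betaHat d w y • d - controlMatrix w *ᵥ gammaHat d w y

/-- The mean squared OLS residual `s²`. -/
def sSq (d : Fin n → ℝ) (w : Fin n → EuclideanSpace ℝ (Fin p)) (y : Fin n → ℝ) : ℝ :=
  (n : ℝ)⁻¹ * (residual d w y ⬝ᵥ residual d w y)

/-- The residual maker `M_W = I - W (WᵀW)⁻¹ Wᵀ`. -/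
def residualMaker (w : Fin n → EuclideanSpace ℝ (Fin p)) : Matrix (Fin n) (Fin n) ℝ :=
  1 - controlMatrix w * ((controlMatrix w)ᵀ * controlMatrix w)⁻¹ * (controlMatrix w)ᵀ

/-- The regressor of interest with the controls partialled out, `M_W D`. -/
def dBreve (d : Fin n → ℝ) (w : Fin n → EuclideanSpace ℝ (Fin p)) : Fin n → ℝ :=
  residualMaker w *ᵥ d

/-- The variance estimate `s² (D̆ᵀ D̆)⁻¹` of `β̂`, with `D̆ = M_W D`. -/
def varBreve (d : Fin n → ℝ) (w : Fin n → EuclideanSpace ℝ (Fin p)) (y : Fin n → ℝ) : ℝ :=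
  sSq d w y * (dBreve d w ⬝ᵥ dBreve d w)⁻¹

/-- The textbook homoskedastic variance estimate of `β̂`: the diagonal entry of
`s² (XᵀX)⁻¹` that belongs to the regressor of interest. -/
def varTextbook (d : Fin n → ℝ) (w : Fin n → EuclideanSpace ℝ (Fin p)) (y : Fin n → ℝ) : ℝ :=
  (sSq d w y • ((designMatrix d w)ᵀ * designMatrix d w)⁻¹) (Sum.inl ()) (Sum.inl ())

end OLSArray

end

/-! Write `M` for the residual maker and `C` for the centred regressor `D - μ_d`. By
Frisch–Waugh–Lovell, the estimation error is `DᵀMε / DᵀMD`. The controls contain an intercept, so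
`M` annihilates constants and `D` may be replaced by `C`. Then CᵀMε = Cᵀε - (WᵀC)ᵀ(WᵀW)⁻¹(Wᵀε).
Since `C` is centred with independent entries and is independent of `W`, a second moment computation
gives ‖WᵀC‖ = O_p(√n). By assumption ‖Wᵀε‖ = o_p(n), and the eigenvalue condition gives ‖(WᵀW)⁻¹‖ =
O_p(1/n), so the correction is o_p(√n). The same estimate shows that n⁻¹CᵀMC and n⁻¹εᵀMε differ from
the raw mean squares by o_p(1). A weak law for `C` (by truncation) and the assumed one for `ε` then
give consistency of the variance estimate.

The central limit theorem concerns Cᵀε / (σ_d‖ε‖). Given `ε`, this is a sum of independent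
standardized variables with weights of unit Euclidean norm. Its conditional characteristic function
is a product that differs from exp(-t²/2) by a multiple of a Lyapunov sum, which vanishes in
probability; bounded convergence removes the conditioning. Normalizing by the realized ‖ε‖ makes the
conditional limit the same for all errors, so the errors may depend on each other and on `W`.

The variances move with `n`, so Slutsky arguments compare random sequences with numerical sequences
bounded above and away from zero. The textbook formula agrees with the partialled-out one because
the relevant entry of (XᵀX)⁻¹ is the inverse of a scalar Schur complement.

The weight is carried by `betaHat_sub`, `sSq_eq`, `inv_designMatrix_inl`,
`abs_dotProduct_residualMaker_sub_le`, `isBoundedOP_sum_sq`, `tendsto_integral_exp_weighted_sum` and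
`studentized_sub_isLittleOP`. -/

namespace OLSArray

/-! ### Calculus of o_p and O_p over changing probability spaces -/

section StochasticOrder

variable {Ω : ℕ → Type*} [∀ n, MeasurableSpace (Ω n)] {P : ∀ n, Measure (Ω n)}

/-- The events `E n` have probability tending to one. -/
def HighProb (P : ∀ n, Measure (Ω n)) (E : ∀ n, Ω n → Prop) : Prop :=
  Tendsto (fun n => P n {ω | ¬ E n ω}) atTop (𝓝 0)

/-- `R n = O_p(1)`. -/
def IsBoundedOP (P : ∀ n, Measure (Ω n)) (R : ∀ n, Ω n → ℝ) : Prop :=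
  ∀ η : ENNReal, 0 < η → ∃ M : ℝ, ∀ᶠ n in atTop, P n {ω | M < |R n ω|} ≤ η

theorem HighProb.mono {E F : ∀ n, Ω n → Prop} (hE : HighProb P E)
    (h : ∀ᶠ n in atTop, ∀ᵐ ω ∂(P n), E n ω → F n ω) : HighProb P F := by
  refine tendsto_of_tendsto_of_tendsto_of_le_of_le' tendsto_const_nhds hE
    (Eventually.of_forall fun _ => zero_le) ?_
  filter_upwards [h] with n hn
  refine measure_mono_ae ?_
  filter_upwards [hn] with ω hω hF hE'
  exact hF (hω hE')

theorem HighProb.imp {E F : ∀ n, Ω n → Prop} (hE : HighProb P E)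
    (h : ∀ n ω, E n ω → F n ω) : HighProb P F :=
  hE.mono (Eventually.of_forall fun n => Eventually.of_forall (h n))

theorem HighProb.and {E F : ∀ n, Ω n → Prop} (hE : HighProb P E) (hF : HighProb P F) :
    HighProb P fun n ω => E n ω ∧ F n ω := by
  have h := hE.add hF
  rw [add_zero] at h
  refine tendsto_of_tendsto_of_tendsto_of_le_of_le tendsto_const_nhds h
    (fun _ => zero_le) fun n => ?_
  refine (measure_mono fun ω hω => ?_).trans (measure_union_le _ _)
  simp only [Set.mem_ofPred_eq, Set.mem_union] at hω ⊢
  tauto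

theorem HighProb.of_eventually {E : ∀ n, Ω n → Prop}
    (h : ∀ᶠ n in atTop, ∀ᵐ ω ∂(P n), E n ω) : HighProb P E := by
  refine Tendsto.congr' ?_ tendsto_const_nhds
  filter_upwards [h] with n hn
  exact (ae_iff.1 hn).symm

theorem isLittleOP_iff_highProb {R : ∀ n, Ω n → ℝ} :
    IsLittleOP P R ↔ ∀ η : ℝ, 0 < η → HighProb P fun n ω => |R n ω| < η := by
  simp only [IsLittleOP, HighProb, not_lt]

theorem IsLittleOP.highProb {R : ∀ n, Ω n → ℝ} (h : IsLittleOP P R) {η : ℝ} (hη : 0 < η) :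
    HighProb P fun n ω => |R n ω| < η :=
  isLittleOP_iff_highProb.1 h η hη

/-- Domination on events of probability tending to one is enough. This is how finite-sample
identities that need invertible matrices enter the asymptotics. -/
theorem IsLittleOP.of_le {R S : ∀ n, Ω n → ℝ} (hS : IsLittleOP P S)
    (h : HighProb P fun n ω => |R n ω| ≤ |S n ω|) : IsLittleOP P R :=
  isLittleOP_iff_highProb.2 fun _ hη =>
    ((hS.highProb hη).and h).imp fun _ _ hω => hω.2.trans_lt hω.1

theorem IsLittleOP.congr {R S : ∀ n, Ω n → ℝ} (hS : IsLittleOP P S)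
    (h : HighProb P fun n ω => R n ω = S n ω) : IsLittleOP P R :=
  hS.of_le (h.imp fun _ _ hω => by rw [hω])

theorem IsLittleOP.neg {R : ∀ n, Ω n → ℝ} (h : IsLittleOP P R) :
    IsLittleOP P fun n ω => -R n ω := by
  simpa only [IsLittleOP, abs_neg] using h

theorem IsLittleOP.add {R S : ∀ n, Ω n → ℝ} (hR : IsLittleOP P R) (hS : IsLittleOP P S) :
    IsLittleOP P fun n ω => R n ω + S n ω :=
  isLittleOP_iff_highProb.2 fun η hη =>
    ((hR.highProb (half_pos hη)).and (hS.highProb (half_pos hη))).imp fun n ω hω => by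
      linarith [abs_add_le (R n ω) (S n ω), hω.1, hω.2]

theorem IsLittleOP.sub {R S : ∀ n, Ω n → ℝ} (hR : IsLittleOP P R) (hS : IsLittleOP P S) :
    IsLittleOP P fun n ω => R n ω - S n ω := by
  simpa only [sub_eq_add_neg] using hR.add hS.neg

theorem IsBoundedOP.of_le {R S : ∀ n, Ω n → ℝ} (hS : IsBoundedOP P S)
    (h : HighProb P fun n ω => |R n ω| ≤ |S n ω|) : IsBoundedOP P R := by
  intro η hη
  obtain ⟨M, hM⟩ := hS (η / 2) (ENNReal.half_pos hη.ne')
  refine ⟨M, ?_⟩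
  filter_upwards [hM, h.eventually_le_const (ENNReal.half_pos hη.ne')] with n h1 h2
  calc P n {ω | M < |R n ω|}
      ≤ P n ({ω | M < |S n ω|} ∪ {ω | ¬ |R n ω| ≤ |S n ω|}) := by
        refine measure_mono fun ω hω => ?_
        simp only [Set.mem_ofPred_eq, Set.mem_union] at hω ⊢
        by_contra! hc
        linarith [hc.1, hc.2]
    _ ≤ η / 2 + η / 2 := (measure_union_le _ _).trans (add_le_add h1 h2)
    _ = η := ENNReal.add_halves η

theorem IsLittleOP.isBoundedOP {R : ∀ n, Ω n → ℝ} (h : IsLittleOP P R) : IsBoundedOP P R := by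
  intro η hη
  refine ⟨1, ?_⟩
  filter_upwards [(h 1 one_pos).eventually_le_const hη] with n hn
  exact (measure_mono fun ω (hω : 1 < |R n ω|) => hω.le).trans hn

theorem IsBoundedOP.of_bounded {c : ℕ → ℝ} {C : ℝ} (h : ∀ᶠ n in atTop, |c n| ≤ C) :
    IsBoundedOP P fun n _ => c n := by
  intro η _
  refine ⟨C, ?_⟩
  filter_upwards [h] with n hn
  simp [not_lt.2 hn]

theorem IsBoundedOP.add {R S : ∀ n, Ω n → ℝ} (hR : IsBoundedOP P R) (hS : IsBoundedOP P S) :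
    IsBoundedOP P fun n ω => R n ω + S n ω := by
  intro η hη
  obtain ⟨M, hM⟩ := hR (η / 2) (ENNReal.half_pos hη.ne')
  obtain ⟨N, hN⟩ := hS (η / 2) (ENNReal.half_pos hη.ne')
  refine ⟨M + N, ?_⟩
  filter_upwards [hM, hN] with n h1 h2
  calc P n {ω | M + N < |R n ω + S n ω|}
      ≤ P n ({ω | M < |R n ω|} ∪ {ω | N < |S n ω|}) := by
        refine measure_mono fun ω hω => ?_
        simp only [Set.mem_ofPred_eq, Set.mem_union] at hω ⊢
        by_contra! hc
        linarith [hc.1, hc.2, abs_add_le (R n ω) (S n ω)]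
    _ ≤ η / 2 + η / 2 := (measure_union_le _ _).trans (add_le_add h1 h2)
    _ = η := ENNReal.add_halves η

theorem IsBoundedOP.mul {R S : ∀ n, Ω n → ℝ} (hR : IsBoundedOP P R) (hS : IsBoundedOP P S) :
    IsBoundedOP P fun n ω => R n ω * S n ω := by
  intro η hη
  obtain ⟨M, hM⟩ := hR (η / 2) (ENNReal.half_pos hη.ne')
  obtain ⟨N, hN⟩ := hS (η / 2) (ENNReal.half_pos hη.ne')
  refine ⟨M * N, ?_⟩
  filter_upwards [hM, hN] with n h1 h2
  calc P n {ω | M * N < |R n ω * S n ω|}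
      ≤ P n ({ω | M < |R n ω|} ∪ {ω | N < |S n ω|}) := by
        refine measure_mono fun ω hω => ?_
        simp only [Set.mem_ofPred_eq, Set.mem_union] at hω ⊢
        by_contra! hc
        rw [abs_mul] at hω
        exact absurd hω (not_lt.2 (mul_le_mul hc.1 hc.2 (abs_nonneg _)
          ((abs_nonneg _).trans hc.1)))
    _ ≤ η / 2 + η / 2 := (measure_union_le _ _).trans (add_le_add h1 h2)
    _ = η := ENNReal.add_halves η

theorem IsBoundedOP.mul_isLittleOP {R S : ∀ n, Ω n → ℝ} (hR : IsBoundedOP P R)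
    (hS : IsLittleOP P S) : IsLittleOP P fun n ω => R n ω * S n ω := by
  intro ρ hρ
  rw [ENNReal.tendsto_nhds_zero]
  intro η hη
  obtain ⟨M, hM⟩ := hR (η / 2) (ENNReal.half_pos hη.ne')
  -- `M` may be zero or negative; |M| + 1 is a positive bound in every case.
  have hpos : 0 < ρ / (|M| + 1) := by positivity
  filter_upwards [hM, (hS _ hpos).eventually_le_const (ENNReal.half_pos hη.ne')] with n h1 h2
  calc P n {ω | ρ ≤ |R n ω * S n ω|}
      ≤ P n ({ω | M < |R n ω|} ∪ {ω | ρ / (|M| + 1) ≤ |S n ω|}) := by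
        refine measure_mono fun ω hω => ?_
        simp only [Set.mem_ofPred_eq, Set.mem_union] at hω ⊢
        by_contra! hc
        rw [abs_mul] at hω
        have h3 : |R n ω| ≤ |M| + 1 := by linarith [hc.1, le_abs_self M]
        have h4 : |R n ω| * |S n ω| ≤ (|M| + 1) * |S n ω| :=
          mul_le_mul_of_nonneg_right h3 (abs_nonneg _)
        have h5 := (lt_div_iff₀' (by positivity)).1 hc.2
        linarith
    _ ≤ η / 2 + η / 2 := (measure_union_le _ _).trans (add_le_add h1 h2)
    _ = η := ENNReal.add_halves η

theorem IsLittleOP.of_tendsto {c : ℕ → ℝ} (h : Tendsto c atTop (𝓝 0)) :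
    IsLittleOP P fun n _ => c n := by
  refine isLittleOP_iff_highProb.2 fun η hη => HighProb.of_eventually ?_
  filter_upwards [(tendsto_zero_iff_abs_tendsto_zero _).1 h |>.eventually_lt_const hη] with n hn
  exact Eventually.of_forall fun _ => hn

theorem IsLittleOP.const_mul {R : ∀ n, Ω n → ℝ} (h : IsLittleOP P R) (c : ℝ) :
    IsLittleOP P fun n ω => c * R n ω :=
  (IsBoundedOP.of_bounded (c := fun _ => c) (C := |c|)
    (Eventually.of_forall fun _ => le_rfl)).mul_isLittleOP h

theorem IsLittleOP.of_lintegral_le {R : ∀ n, Ω n → ℝ} (hR : ∀ n, AEMeasurable (R n) (P n))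
    {c : ℕ → ℝ} (hc : Tendsto c atTop (𝓝 0))
    (h : ∀ᶠ n in atTop, ∫⁻ ω, ‖R n ω‖ₑ ∂(P n) ≤ ENNReal.ofReal (c n)) : IsLittleOP P R := by
  intro η hη
  have hη' : ENNReal.ofReal η ≠ 0 := by simpa using hη
  have hlim : Tendsto (fun n => ENNReal.ofReal (c n) / ENNReal.ofReal η) atTop (𝓝 0) := by
    have := ENNReal.Tendsto.div_const (ENNReal.tendsto_ofReal hc) (b := ENNReal.ofReal η)
      (Or.inr hη')
    simpa using this
  refine tendsto_of_tendsto_of_tendsto_of_le_of_le' tendsto_const_nhds hlim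
    (Eventually.of_forall fun _ => zero_le) ?_
  filter_upwards [h] with n hn
  rw [ENNReal.le_div_iff_mul_le (Or.inl hη') (Or.inl ENNReal.ofReal_ne_top), mul_comm]
  refine le_trans ?_ ((mul_meas_ge_le_lintegral₀ (hR n).enorm (ENNReal.ofReal η)).trans hn)
  gcongr with ω
  intro hω
  rw [Real.enorm_eq_ofReal_abs]
  exact ENNReal.ofReal_le_ofReal hω

theorem IsBoundedOP.of_lintegral_le {R : ∀ n, Ω n → ℝ} (hR : ∀ n, AEMeasurable (R n) (P n))
    {C : ℝ} (h : ∀ᶠ n in atTop, ∫⁻ ω, ‖R n ω‖ₑ ∂(P n) ≤ ENNReal.ofReal C) :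
    IsBoundedOP P R := by
  intro η hη
  have hlim : Tendsto (fun k : ℕ => ENNReal.ofReal C / (k + 1 : ℕ)) atTop (𝓝 0) := by
    have h1 : Tendsto (fun k : ℕ => ENNReal.ofReal C * ((k : ENNReal))⁻¹) atTop (𝓝 0) := by
      simpa using ENNReal.Tendsto.const_mul ENNReal.tendsto_inv_nat_nhds_zero
        (a := ENNReal.ofReal C) (Or.inr ENNReal.ofReal_ne_top)
    exact h1.comp (tendsto_add_atTop_nat 1)
  obtain ⟨k, hk⟩ := (hlim.eventually_le_const hη).exists
  refine ⟨(k + 1 : ℕ), ?_⟩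
  filter_upwards [h] with n hn
  refine le_trans ?_ hk
  rw [ENNReal.le_div_iff_mul_le (Or.inl (by simp)) (Or.inl (by simp)), mul_comm]
  refine le_trans ?_ ((mul_meas_ge_le_lintegral₀ (hR n).enorm ((k + 1 : ℕ) : ENNReal)).trans hn)
  gcongr with ω
  intro hω
  rw [Real.enorm_eq_ofReal_abs, ← ENNReal.ofReal_natCast]
  exact ENNReal.ofReal_le_ofReal hω.le

theorem IsBoundedOP.of_sq {R : ∀ n, Ω n → ℝ} (h : IsBoundedOP P fun n ω => R n ω ^ 2) :
    IsBoundedOP P R := by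
  have h1 := h.add (IsBoundedOP.of_bounded (P := P) (c := fun _ => 1) (C := 1) (by simp))
  refine h1.of_le (HighProb.of_eventually (Eventually.of_forall fun n =>
    Eventually.of_forall fun ω => ?_))
  rw [abs_of_nonneg (by positivity : (0 : ℝ) ≤ R n ω ^ 2 + 1)]
  nlinarith [sq_nonneg (|R n ω| - 1), sq_abs (R n ω), abs_nonneg (R n ω)]

/-- The centre `c n` may move with `n`. Once |X - c| < c₀/2, both values are at least c₀/2 and their
product is at least c₀²/2, whence the Lipschitz constant 2/c₀². -/
theorem IsLittleOP.inv {X : ∀ n, Ω n → ℝ} {c : ℕ → ℝ} {c₀ : ℝ} (hc₀ : 0 < c₀)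
    (hc : ∀ᶠ n in atTop, c₀ ≤ c n) (h : IsLittleOP P fun n ω => X n ω - c n) :
    IsLittleOP P fun n ω => (X n ω)⁻¹ - (c n)⁻¹ := by
  refine (h.const_mul (2 / c₀ ^ 2)).of_le ((h.highProb (half_pos hc₀)).mono ?_)
  filter_upwards [hc] with n hn
  refine Eventually.of_forall fun ω hω => ?_
  have hx : c₀ / 2 ≤ X n ω := by linarith [(abs_lt.1 hω).1]
  have hx0 : 0 < X n ω := by linarith
  have hc0 : 0 < c n := by linarith
  rw [inv_sub_inv hx0.ne' hc0.ne', abs_div, abs_mul (2 / c₀ ^ 2), abs_sub_comm (c n),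
    abs_of_pos (mul_pos hx0 hc0), abs_of_pos (by positivity : 0 < 2 / c₀ ^ 2), div_mul_eq_mul_div,
    div_le_div_iff₀ (mul_pos hx0 hc0) (by positivity)]
  have : c₀ ^ 2 ≤ 2 * (X n ω * c n) := by nlinarith
  nlinarith [abs_nonneg (X n ω - c n)]

/-- The difference of the roots is X - c divided by √X + √c, and this denominator is at least √c₀.
-/
theorem IsLittleOP.sqrt {X : ∀ n, Ω n → ℝ} {c : ℕ → ℝ} {c₀ : ℝ} (hc₀ : 0 < c₀)
    (hc : ∀ᶠ n in atTop, c₀ ≤ c n) (h : IsLittleOP P fun n ω => X n ω - c n) :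
    IsLittleOP P fun n ω => √(X n ω) - √(c n) := by
  refine (h.const_mul (1 / √c₀)).of_le ((h.highProb hc₀).mono ?_)
  filter_upwards [hc] with n hn
  refine Eventually.of_forall fun ω hω => ?_
  have hx0 : 0 < X n ω := by linarith [(abs_lt.1 hω).1]
  have hs : 0 < √c₀ := Real.sqrt_pos.2 hc₀
  have hs2 : √c₀ ≤ √(c n) := Real.sqrt_le_sqrt hn
  have heq : X n ω - c n = (√(X n ω) - √(c n)) * (√(X n ω) + √(c n)) := by
    nlinarith [Real.sq_sqrt hx0.le, Real.sq_sqrt (hc₀.le.trans hn)]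
  rw [abs_mul, abs_of_pos (by positivity : 0 < 1 / √c₀), heq, abs_mul, div_mul_eq_mul_div, one_mul,
    le_div_iff₀ hs]
  refine mul_le_mul_of_nonneg_left ?_ (abs_nonneg _)
  exact (hs2.trans (by linarith [Real.sqrt_nonneg (X n ω)])).trans (le_abs_self _)

end StochasticOrder

end OLSArray

namespace OLSArray

/-! ### Partialling out and exact finite-sample formulas -/

section Algebra

variable {n p : ℕ}

theorem dotProduct_residualMaker (w : Fin n → EuclideanSpace ℝ (Fin p)) (u v : Fin n → ℝ) :
    u ⬝ᵥ (residualMaker w *ᵥ v) = u ⬝ᵥ v - ((controlMatrix w)ᵀ *ᵥ u) ⬝ᵥ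
      (((controlMatrix w)ᵀ * controlMatrix w)⁻¹ *ᵥ ((controlMatrix w)ᵀ *ᵥ v)) := by
  rw [residualMaker, Matrix.sub_mulVec, Matrix.one_mulVec, dotProduct_sub,
    ← Matrix.mulVec_mulVec, ← Matrix.mulVec_mulVec, Matrix.dotProduct_mulVec u]
  simp only [Matrix.mulVec_transpose]

theorem residualMaker_transpose (w : Fin n → EuclideanSpace ℝ (Fin p)) :
    (residualMaker w)ᵀ = residualMaker w := by
  simp [residualMaker, Matrix.transpose_mul, Matrix.transpose_nonsing_inv, Matrix.mul_assoc]

theorem residualMaker_dotProduct (w : Fin n → EuclideanSpace ℝ (Fin p)) (u v : Fin n → ℝ) :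
    (residualMaker w *ᵥ u) ⬝ᵥ v = u ⬝ᵥ (residualMaker w *ᵥ v) := by
  rw [Matrix.dotProduct_mulVec u, ← Matrix.mulVec_transpose, residualMaker_transpose]

theorem residualMaker_mul_controlMatrix {w : Fin n → EuclideanSpace ℝ (Fin p)}
    (h : IsUnit ((controlMatrix w)ᵀ * controlMatrix w).det) :
    residualMaker w * controlMatrix w = 0 := by
  rw [residualMaker, Matrix.sub_mul, Matrix.one_mul, Matrix.mul_assoc, Matrix.mul_assoc,
    Matrix.nonsing_inv_mul _ h, Matrix.mul_one, sub_self]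

theorem controlMatrix_transpose_mul_residualMaker {w : Fin n → EuclideanSpace ℝ (Fin p)}
    (h : IsUnit ((controlMatrix w)ᵀ * controlMatrix w).det) :
    (controlMatrix w)ᵀ * residualMaker w = 0 := by
  rw [← residualMaker_transpose, ← Matrix.transpose_mul, residualMaker_mul_controlMatrix h,
    Matrix.transpose_zero]

theorem residualMaker_mul_self {w : Fin n → EuclideanSpace ℝ (Fin p)}
    (h : IsUnit ((controlMatrix w)ᵀ * controlMatrix w).det) :
    residualMaker w * residualMaker w = residualMaker w := by
  conv_lhs => lhs; rw [residualMaker]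
  rw [Matrix.sub_mul, Matrix.one_mul, Matrix.mul_assoc, controlMatrix_transpose_mul_residualMaker h,
    Matrix.mul_zero, sub_zero]

/-- The constant vector μ is μ/c times column `k` of the controls, which the residual maker
annihilates. This makes centring of the regressor free. -/
theorem residualMaker_mulVec_sub_const {w : Fin n → EuclideanSpace ℝ (Fin p)}
    (h : IsUnit ((controlMatrix w)ᵀ * controlMatrix w).det) {c : ℝ} (hc : c ≠ 0) {k : Fin p}
    (hw : ∀ i, w i k = c) (d : Fin n → ℝ) (μ : ℝ) :
    residualMaker w *ᵥ (fun i => d i - μ) = residualMaker w *ᵥ d := by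
  have h1 : (fun i => d i - μ) = d - controlMatrix w *ᵥ (Pi.single k (μ / c)) := by
    ext i
    simp only [controlMatrix, Pi.sub_apply, Matrix.mulVec_single, Matrix.of_apply, Matrix.col_apply,
      Pi.smul_apply, MulOpposite.smul_eq_mul_unop, MulOpposite.unop_op, hw i]
    rw [mul_div_cancel₀ _ hc]
  rw [h1, Matrix.mulVec_sub, Matrix.mulVec_mulVec, residualMaker_mul_controlMatrix h,
    Matrix.zero_mulVec, sub_zero]

theorem dBreve_dotProduct_dBreve {w : Fin n → EuclideanSpace ℝ (Fin p)}
    (h : IsUnit ((controlMatrix w)ᵀ * controlMatrix w).det) (d : Fin n → ℝ) :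
    dBreve d w ⬝ᵥ dBreve d w = d ⬝ᵥ (residualMaker w *ᵥ d) := by
  rw [dBreve, residualMaker_dotProduct, Matrix.mulVec_mulVec, residualMaker_mul_self h]

theorem designMatrix_gram (d : Fin n → ℝ) (w : Fin n → EuclideanSpace ℝ (Fin p)) :
    (designMatrix d w)ᵀ * designMatrix d w =
      Matrix.fromBlocks ((Matrix.replicateCol Unit d)ᵀ * Matrix.replicateCol Unit d)
        ((Matrix.replicateCol Unit d)ᵀ * controlMatrix w)
        ((controlMatrix w)ᵀ * Matrix.replicateCol Unit d)
        ((controlMatrix w)ᵀ * controlMatrix w) := by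
  rw [designMatrix, Matrix.transpose_fromCols, Matrix.fromRows_mul_fromCols]

/-- The Schur complement of the control block in the Gram matrix of (D, W) is DᵀMD, a 1 × 1 matrix;
idempotence of M turns it into the squared length of MD. -/
theorem schur_eq (d : Fin n → ℝ) (w : Fin n → EuclideanSpace ℝ (Fin p))
    (h : IsUnit ((controlMatrix w)ᵀ * controlMatrix w).det) :
    (Matrix.replicateCol Unit d)ᵀ * Matrix.replicateCol Unit d -
      (Matrix.replicateCol Unit d)ᵀ * controlMatrix w *
        ((controlMatrix w)ᵀ * controlMatrix w)⁻¹ *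
        ((controlMatrix w)ᵀ * Matrix.replicateCol Unit d) =
      Matrix.of fun _ _ => dBreve d w ⬝ᵥ dBreve d w := by
  have h1 : (Matrix.replicateCol Unit d)ᵀ * Matrix.replicateCol Unit d -
      (Matrix.replicateCol Unit d)ᵀ * controlMatrix w *
        ((controlMatrix w)ᵀ * controlMatrix w)⁻¹ *
        ((controlMatrix w)ᵀ * Matrix.replicateCol Unit d) =
      (Matrix.replicateCol Unit d)ᵀ * (residualMaker w * Matrix.replicateCol Unit d) := by
    rw [residualMaker, Matrix.sub_mul, Matrix.one_mul, Matrix.mul_sub]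
    simp only [Matrix.mul_assoc]
  rw [h1, dBreve_dotProduct_dBreve h]
  ext i j
  simp [Matrix.mul_apply, dotProduct, Matrix.mulVec]

theorem isUnit_det_designMatrix {d : Fin n → ℝ} {w : Fin n → EuclideanSpace ℝ (Fin p)}
    (h : IsUnit ((controlMatrix w)ᵀ * controlMatrix w).det)
    (hd : dBreve d w ⬝ᵥ dBreve d w ≠ 0) :
    IsUnit ((designMatrix d w)ᵀ * designMatrix d w).det := by
  let _ := Matrix.invertibleOfIsUnitDet _ h
  rw [designMatrix_gram, Matrix.det_fromBlocks₂₂, Matrix.invOf_eq_nonsing_inv, schur_eq d w h]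
  refine h.mul ?_
  simpa using hd

/-- In the block inverse formula, the upper left block is the inverse of the Schur complement, which
is scalar here. -/
theorem inv_designMatrix_inl {d : Fin n → ℝ} {w : Fin n → EuclideanSpace ℝ (Fin p)}
    (h : IsUnit ((controlMatrix w)ᵀ * controlMatrix w).det)
    (hd : dBreve d w ⬝ᵥ dBreve d w ≠ 0) :
    ((designMatrix d w)ᵀ * designMatrix d w)⁻¹ (Sum.inl ()) (Sum.inl ()) =
      (dBreve d w ⬝ᵥ dBreve d w)⁻¹ := by
  have hX := isUnit_det_designMatrix h hd
  rw [designMatrix_gram] at hX ⊢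
  let _ := Matrix.invertibleOfIsUnitDet _ h
  let _ := Matrix.invertibleOfIsUnitDet _ hX
  let _ := Matrix.invertibleOfFromBlocks₂₂Invertible
    ((Matrix.replicateCol Unit d)ᵀ * Matrix.replicateCol Unit d)
    ((Matrix.replicateCol Unit d)ᵀ * controlMatrix w)
    ((controlMatrix w)ᵀ * Matrix.replicateCol Unit d)
    ((controlMatrix w)ᵀ * controlMatrix w)
  rw [← Matrix.invOf_eq_nonsing_inv, Matrix.invOf_fromBlocks₂₂_eq, Matrix.fromBlocks_apply₁₁,
    Matrix.invOf_eq_nonsing_inv, Matrix.invOf_eq_nonsing_inv, schur_eq d w h, Matrix.inv_def,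
    Matrix.adjugate_subsingleton]
  simp

theorem designMatrix_mulVec (d : Fin n → ℝ) (w : Fin n → EuclideanSpace ℝ (Fin p))
    (θ : Unit ⊕ Fin p → ℝ) :
    designMatrix d w *ᵥ θ =
      θ (Sum.inl ()) • d + controlMatrix w *ᵥ fun j => θ (Sum.inr j) := by
  ext i
  simp [designMatrix, Matrix.mulVec, dotProduct, mul_comm]

theorem residual_eq (d : Fin n → ℝ) (w : Fin n → EuclideanSpace ℝ (Fin p)) (y : Fin n → ℝ) :
    residual d w y = y - designMatrix d w *ᵥ thetaHat d w y := by
  rw [designMatrix_mulVec, residual, sub_sub]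
  rfl

theorem designMatrix_transpose_mulVec_residual {d : Fin n → ℝ}
    {w : Fin n → EuclideanSpace ℝ (Fin p)}
    (hX : IsUnit ((designMatrix d w)ᵀ * designMatrix d w).det) (y : Fin n → ℝ) :
    (designMatrix d w)ᵀ *ᵥ residual d w y = 0 := by
  rw [residual_eq, thetaHat, Matrix.mulVec_sub, Matrix.mulVec_mulVec, Matrix.mulVec_mulVec,
    Matrix.mul_nonsing_inv _ hX, Matrix.one_mulVec, sub_self]

theorem designMatrix_transpose_mulVec_inl (d : Fin n → ℝ)
    (w : Fin n → EuclideanSpace ℝ (Fin p)) (e : Fin n → ℝ) :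
    ((designMatrix d w)ᵀ *ᵥ e) (Sum.inl ()) = d ⬝ᵥ e := by
  simp [designMatrix, Matrix.mulVec, dotProduct]

theorem designMatrix_transpose_mulVec_inr (d : Fin n → ℝ)
    (w : Fin n → EuclideanSpace ℝ (Fin p)) (e : Fin n → ℝ) (j : Fin p) :
    ((designMatrix d w)ᵀ *ᵥ e) (Sum.inr j) = ((controlMatrix w)ᵀ *ᵥ e) j := by
  simp [designMatrix, Matrix.mulVec, dotProduct]

variable {d : Fin n → ℝ} {w : Fin n → EuclideanSpace ℝ (Fin p)} {y ε : Fin n → ℝ} {β : ℝ}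
  {γ : EuclideanSpace ℝ (Fin p)}

/-- The normal equations make the residual orthogonal to the controls, so M fixes it. Applying M to
the model form of the residual removes every term in the span of the controls. -/
theorem residual_eq_residualMaker (h : IsUnit ((controlMatrix w)ᵀ * controlMatrix w).det)
    (hd : dBreve d w ⬝ᵥ dBreve d w ≠ 0)
    (hy : ∀ i, y i = d i * β + inner ℝ (w i) γ + ε i) :
    residual d w y = residualMaker w *ᵥ ε - (betaHat d w y - β) • dBreve d w := by
  have hX := designMatrix_transpose_mulVec_residual (isUnit_det_designMatrix h hd) y
  have hW : (controlMatrix w)ᵀ *ᵥ residual d w y = 0 := by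
    ext j
    rw [← designMatrix_transpose_mulVec_inr d, hX]
    rfl
  have hM : residualMaker w *ᵥ residual d w y = residual d w y := by
    rw [residualMaker, Matrix.sub_mulVec, ← Matrix.mulVec_mulVec, hW, Matrix.mulVec_zero,
      Matrix.one_mulVec, sub_zero]
  have hy' : y = β • d + controlMatrix w *ᵥ (fun j => γ j) + ε := by
    ext i
    simp [hy i, controlMatrix, Matrix.mulVec, dotProduct, PiLp.inner_apply, mul_comm]
  have hr : residual d w y = ε - (betaHat d w y - β) • d -
      controlMatrix w *ᵥ (gammaHat d w y - fun j => γ j) := by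
    rw [residual, Matrix.mulVec_sub]
    nth_rewrite 1 [hy']
    rw [sub_smul]
    abel
  rw [← hM, hr, Matrix.mulVec_sub, Matrix.mulVec_mulVec, residualMaker_mul_controlMatrix h,
    Matrix.zero_mulVec, sub_zero, Matrix.mulVec_sub, Matrix.mulVec_smul, dBreve]

/-- Frisch–Waugh–Lovell: the normal equation for `d`, combined with the preceding form of the
residual, is one linear equation in the estimation error. -/
theorem betaHat_sub (h : IsUnit ((controlMatrix w)ᵀ * controlMatrix w).det)
    (hd : dBreve d w ⬝ᵥ dBreve d w ≠ 0)
    (hy : ∀ i, y i = d i * β + inner ℝ (w i) γ + ε i) :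
    betaHat d w y - β = (d ⬝ᵥ (residualMaker w *ᵥ ε)) / (dBreve d w ⬝ᵥ dBreve d w) := by
  have hX := designMatrix_transpose_mulVec_residual (isUnit_det_designMatrix h hd) y
  have h1 : d ⬝ᵥ residual d w y = 0 := by
    rw [← designMatrix_transpose_mulVec_inl d w, hX]
    rfl
  rw [residual_eq_residualMaker h hd hy, dotProduct_sub, dotProduct_smul, smul_eq_mul] at h1
  rw [eq_div_iff hd, dBreve_dotProduct_dBreve h]
  rw [dBreve] at h1
  linarith

/-- Pythagoras: the residual is Mε minus its projection onto MD, and the subtracted quotient is the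
squared length of that projection. -/
theorem sSq_eq (h : IsUnit ((controlMatrix w)ᵀ * controlMatrix w).det)
    (hd : dBreve d w ⬝ᵥ dBreve d w ≠ 0)
    (hy : ∀ i, y i = d i * β + inner ℝ (w i) γ + ε i) :
    sSq d w y = (n : ℝ)⁻¹ * (ε ⬝ᵥ (residualMaker w *ᵥ ε) -
      (d ⬝ᵥ (residualMaker w *ᵥ ε)) ^ 2 / (dBreve d w ⬝ᵥ dBreve d w)) := by
  have h1 : (residualMaker w *ᵥ ε) ⬝ᵥ (residualMaker w *ᵥ ε) = ε ⬝ᵥ (residualMaker w *ᵥ ε) := by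
    rw [residualMaker_dotProduct, Matrix.mulVec_mulVec, residualMaker_mul_self h]
  have h2 : dBreve d w ⬝ᵥ (residualMaker w *ᵥ ε) = d ⬝ᵥ (residualMaker w *ᵥ ε) := by
    rw [dBreve, residualMaker_dotProduct, Matrix.mulVec_mulVec, residualMaker_mul_self h]
  rw [sSq, residual_eq_residualMaker h hd hy, betaHat_sub h hd hy]
  simp only [dotProduct_sub, sub_dotProduct, dotProduct_smul, smul_dotProduct, smul_eq_mul, h1, h2,
    dotProduct_comm (residualMaker w *ᵥ ε) (dBreve d w)]
  field_simp
  ring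

theorem varTextbook_eq_varBreve (h : IsUnit ((controlMatrix w)ᵀ * controlMatrix w).det)
    (hd : dBreve d w ⬝ᵥ dBreve d w ≠ 0) : varTextbook d w y = varBreve d w y := by
  rw [varTextbook, varBreve, Matrix.smul_apply, inv_designMatrix_inl h hd, smul_eq_mul]

/-- For z = A⁻¹y, coercivity and Cauchy–Schwarz give κ‖z‖² ≤ z·y ≤ ‖z‖‖y‖, hence ‖z‖ ≤ ‖y‖/κ.
Symmetry of `A` plays no role. -/
theorem abs_dotProduct_inv_mulVec_le {A : Matrix (Fin p) (Fin p) ℝ} {κ : ℝ} (hκ : 0 < κ)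
    (hdet : IsUnit A.det) (hA : ∀ z : Fin p → ℝ, κ * (z ⬝ᵥ z) ≤ z ⬝ᵥ (A *ᵥ z))
    (x y : Fin p → ℝ) : |x ⬝ᵥ (A⁻¹ *ᵥ y)| ≤ κ⁻¹ * (√(x ⬝ᵥ x) * √(y ⬝ᵥ y)) := by
  have hcs : ∀ u v : Fin p → ℝ, |u ⬝ᵥ v| ≤ √(u ⬝ᵥ u) * √(v ⬝ᵥ v) := by
    intro u v
    rw [← Real.sqrt_mul (by simpa using dotProduct_self_star_nonneg u)]
    refine Real.abs_le_sqrt ?_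
    have := Finset.sum_mul_sq_le_sq_mul_sq Finset.univ u v
    simpa [dotProduct, sq] using this
  set z := A⁻¹ *ᵥ y with hz
  have hAz : A *ᵥ z = y := by
    rw [hz, Matrix.mulVec_mulVec, Matrix.mul_nonsing_inv _ hdet, Matrix.one_mulVec]
  have h0 : 0 ≤ z ⬝ᵥ z := by simpa using dotProduct_self_star_nonneg z
  have h1 : κ * (√(z ⬝ᵥ z) * √(z ⬝ᵥ z)) ≤ √(z ⬝ᵥ z) * √(y ⬝ᵥ y) := by
    rw [Real.mul_self_sqrt h0]
    refine (hA z).trans ?_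
    rw [hAz]
    exact (le_abs_self _).trans (hcs z y)
  have h2 : √(z ⬝ᵥ z) ≤ κ⁻¹ * √(y ⬝ᵥ y) := by
    rcases (Real.sqrt_nonneg (z ⬝ᵥ z)).eq_or_lt with h | h
    · rw [← h]
      positivity
    · rw [← div_eq_inv_mul, le_div_iff₀ hκ]
      nlinarith
  calc |x ⬝ᵥ z| ≤ √(x ⬝ᵥ x) * √(z ⬝ᵥ z) := hcs x z
    _ ≤ √(x ⬝ᵥ x) * (κ⁻¹ * √(y ⬝ᵥ y)) := by gcongr
    _ = κ⁻¹ * (√(x ⬝ᵥ x) * √(y ⬝ᵥ y)) := by ring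

/-- Subtracting the smallest eigenvalue times the identity shifts the spectrum into the nonnegative
half-line, so the shifted matrix is positive semidefinite. -/
theorem lambdaMin_mul_le {A : Matrix (Fin p) (Fin p) ℝ} (hA : A.IsHermitian) (z : Fin p → ℝ) :
    lambdaMin A * (z ⬝ᵥ z) ≤ z ⬝ᵥ (A *ᵥ z) := by
  have hfin : (spectrum ℝ A).Finite := by
    rw [hA.spectrum_real_eq_range_eigenvalues]
    exact Set.finite_range _
  have hpsd : (A - lambdaMin A • (1 : Matrix (Fin p) (Fin p) ℝ)).PosSemidef := by
    have hH : (A - lambdaMin A • (1 : Matrix (Fin p) (Fin p) ℝ)).IsHermitian :=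
      hA.sub (by simp [Matrix.IsHermitian])
    rw [hH.posSemidef_iff_eigenvalues_nonneg]
    intro i
    have hmem := hH.eigenvalues_mem_spectrum_real i
    show 0 ≤ hH.eigenvalues i
    generalize hH.eigenvalues i = r at hmem
    rw [← Algebra.algebraMap_eq_smul_one, ← spectrum.sub_singleton_eq] at hmem
    obtain ⟨a, ha, b, hb, hab⟩ := hmem
    have : lambdaMin A ≤ a := csInf_le hfin.bddBelow ha
    simp only [Set.mem_singleton_iff] at hb
    rw [← hab, hb]
    simpa using this
  have := hpsd.dotProduct_mulVec_nonneg z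
  rw [star_trivial, Matrix.sub_mulVec, Matrix.smul_mulVec, Matrix.one_mulVec, dotProduct_sub,
    dotProduct_smul, smul_eq_mul] at this
  linarith

end Algebra
end OLSArray

namespace OLSArray

/-! ### Moment bounds and a truncated weak law -/

section Moments

variable {Ω : Type*} [MeasurableSpace Ω] {P : Measure Ω}

theorem lintegral_enorm_le_of_integral_le {f : Ω → ℝ} (hf : Integrable f P) (h0 : ∀ ω, 0 ≤ f ω)
    {C : ℝ} (hC : ∫ ω, f ω ∂P ≤ C) : ∫⁻ ω, ‖f ω‖ₑ ∂P ≤ ENNReal.ofReal C := by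
  rw [← ofReal_integral_norm_eq_lintegral_enorm hf]
  refine ENNReal.ofReal_le_ofReal (le_trans (le_of_eq ?_) hC)
  exact integral_congr_ae (Eventually.of_forall fun ω => Real.norm_of_nonneg (h0 ω))

variable [IsProbabilityMeasure P]

theorem integrable_rpow_of_lintegral_le {X : Ω → ℝ} (hX : Measurable X) {p q K : ℝ} (hp : 0 < p)
    (hpq : p ≤ q) (hK : 0 ≤ K) (h : ∫⁻ ω, ‖X ω‖ₑ ^ q ∂P ≤ ENNReal.ofReal K) :
    Integrable (fun ω => |X ω| ^ p) P ∧ ∫ ω, |X ω| ^ p ∂P ≤ 1 + K := by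
  have hle : ∫⁻ ω, ENNReal.ofReal (|X ω| ^ p) ∂P ≤ ENNReal.ofReal (1 + K) := by
    calc ∫⁻ ω, ENNReal.ofReal (|X ω| ^ p) ∂P
        ≤ ∫⁻ ω, (1 + ‖X ω‖ₑ ^ q) ∂P := by
          refine lintegral_mono fun ω => ?_
          have h1 : |X ω| ^ p ≤ 1 + |X ω| ^ q := by
            rcases le_total |X ω| 1 with h1 | h1
            · have := Real.rpow_le_one (abs_nonneg _) h1 hp.le
              have := Real.rpow_nonneg (abs_nonneg (X ω)) q
              linarith
            · have := Real.rpow_le_rpow_of_exponent_le h1 hpq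
              linarith
          refine (ENNReal.ofReal_le_ofReal h1).trans ?_
          rw [ENNReal.ofReal_add zero_le_one (Real.rpow_nonneg (abs_nonneg _) _),
            ENNReal.ofReal_one, Real.enorm_eq_ofReal_abs,
            ENNReal.ofReal_rpow_of_nonneg (abs_nonneg _) (hp.le.trans hpq)]
      _ = 1 + ∫⁻ ω, ‖X ω‖ₑ ^ q ∂P := by
          rw [lintegral_add_left measurable_const]
          simp
      _ ≤ ENNReal.ofReal (1 + K) := by
          rw [ENNReal.ofReal_add zero_le_one hK, ENNReal.ofReal_one]
          gcongr
  have hnn : 0 ≤ᵐ[P] fun ω => |X ω| ^ p :=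
    Eventually.of_forall fun ω => Real.rpow_nonneg (abs_nonneg _) _
  have hm : Measurable fun ω => |X ω| ^ p := by fun_prop
  have hint : Integrable (fun ω => |X ω| ^ p) P := by
    refine ⟨hm.aestronglyMeasurable, ?_⟩
    rw [hasFiniteIntegral_iff_ofReal hnn]
    exact hle.trans_lt ENNReal.ofReal_lt_top
  refine ⟨hint, ?_⟩
  rw [← ofReal_integral_eq_lintegral_ofReal hint hnn] at hle
  exact (ENNReal.ofReal_le_ofReal_iff (by positivity)).1 hle

theorem memLp_two_of_lintegral_le {X : Ω → ℝ} (hX : Measurable X) {q K : ℝ} (hq : 2 ≤ q)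
    (hK : 0 ≤ K) (h : ∫⁻ ω, ‖X ω‖ₑ ^ q ∂P ≤ ENNReal.ofReal K) :
    MemLp X 2 P ∧ ∫ ω, X ω ^ 2 ∂P ≤ 1 + K := by
  have := integrable_rpow_of_lintegral_le hX two_pos hq hK h
  simp only [Real.rpow_ofNat, sq_abs] at this
  exact ⟨(memLp_two_iff_integrable_sq hX.aestronglyMeasurable).2 this.1, this.2⟩

theorem abs_integral_le_of_lintegral_le {X : Ω → ℝ} (hX : Measurable X) {q K : ℝ} (hq : 1 ≤ q)
    (hK : 0 ≤ K) (h : ∫⁻ ω, ‖X ω‖ₑ ^ q ∂P ≤ ENNReal.ofReal K) :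
    |∫ ω, X ω ∂P| ≤ 1 + K := by
  have := (integrable_rpow_of_lintegral_le hX one_pos hq hK h).2
  simp only [Real.rpow_one] at this
  exact abs_integral_le_integral_abs.trans this

/-- A bound for the absolute moment of order `p` of a centred random variable. -/
noncomputable def centeredMomentBound (p K : ℝ) : ℝ := 2 ^ p * ((1 + K) + (1 + K) ^ p)

theorem centeredMomentBound_nonneg {p K : ℝ} (hK : 0 ≤ K) : 0 ≤ centeredMomentBound p K := by
  unfold centeredMomentBound
  positivity

theorem add_rpow_le {a b p : ℝ} (ha : 0 ≤ a) (hb : 0 ≤ b) (hp : 0 ≤ p) :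
    (a + b) ^ p ≤ 2 ^ p * (a ^ p + b ^ p) := by
  have h1 := Real.rpow_nonneg ha p
  have h2 := Real.rpow_nonneg hb p
  have h3 : (0 : ℝ) ≤ 2 ^ p := by positivity
  rcases le_total a b with h | h
  · calc (a + b) ^ p ≤ (2 * b) ^ p := by gcongr; linarith
      _ = 2 ^ p * b ^ p := Real.mul_rpow two_pos.le hb
      _ ≤ _ := by gcongr; linarith
  · calc (a + b) ^ p ≤ (2 * a) ^ p := by gcongr; linarith
      _ = 2 ^ p * a ^ p := Real.mul_rpow two_pos.le ha
      _ ≤ _ := by gcongr; linarith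

theorem centered_moment_le {X : Ω → ℝ} (hX : Measurable X) {p q K : ℝ} (hp : 1 ≤ p)
    (hpq : p ≤ q) (hK : 0 ≤ K) (h : ∫⁻ ω, ‖X ω‖ₑ ^ q ∂P ≤ ENNReal.ofReal K) :
    Integrable (fun ω => |X ω - ∫ ω', X ω' ∂P| ^ p) P ∧
      ∫ ω, |X ω - ∫ ω', X ω' ∂P| ^ p ∂P ≤ centeredMomentBound p K := by
  have hp0 : 0 < p := by linarith
  obtain ⟨hi, hle⟩ := integrable_rpow_of_lintegral_le hX hp0 hpq hK h
  have hμ := abs_integral_le_of_lintegral_le hX (hp.trans hpq) hK h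
  set μ := ∫ ω', X ω' ∂P
  have hb : ∀ ω, |X ω - μ| ^ p ≤ 2 ^ p * (|X ω| ^ p + (1 + K) ^ p) := by
    intro ω
    refine le_trans ?_ (add_rpow_le (abs_nonneg _) (by positivity) hp0.le)
    refine Real.rpow_le_rpow (abs_nonneg _) ((abs_sub _ _).trans (by linarith)) hp0.le
  have hi2 : Integrable (fun ω => 2 ^ p * (|X ω| ^ p + (1 + K) ^ p)) P :=
    (hi.add (integrable_const _)).const_mul _
  have hi3 : Integrable (fun ω => |X ω - μ| ^ p) P := by
    refine hi2.mono'
      (by fun_prop : Measurable fun ω => |X ω - μ| ^ p).aestronglyMeasurable (Eventually.of_forall fun ω => ?_)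
    rw [Real.norm_of_nonneg (Real.rpow_nonneg (abs_nonneg _) _)]
    exact hb ω
  refine ⟨hi3, (integral_mono hi3 hi2 hb).trans ?_⟩
  rw [integral_const_mul, integral_add hi (integrable_const _)]
  simp only [integral_const, probReal_univ, one_smul]
  unfold centeredMomentBound
  gcongr

/-- Second moment of a weighted sum of centred i.i.d. variables with independent weights. -/
theorem integral_sq_sum_centered {ι : Type*} [Fintype ι] {d x : ι → Ω → ℝ} {μ s : ℝ}
    (hd : ∀ i, MemLp (d i) 2 P) (hdm : ∀ i, Measurable (d i)) (hx : ∀ i, MemLp (x i) 2 P)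
    (hmean : ∀ i, ∫ ω, d i ω ∂P = μ) (hvar : ∀ i, variance (d i) P = s)
    (hind : iIndepFun d P) (hdx : IndepFun (fun ω i => d i ω) (fun ω i => x i ω) P) :
    Integrable (fun ω => (∑ i, (d i ω - μ) * x i ω) ^ 2) P ∧
      ∫ ω, (∑ i, (d i ω - μ) * x i ω) ^ 2 ∂P = s * ∑ i, ∫ ω, x i ω ^ 2 ∂P := by
  classical
  have hd' : ∀ i, MemLp (fun ω => d i ω - μ) 2 P := fun i => (hd i).sub (memLp_const μ)
  have h0 : ∀ i, ∫ ω, (d i ω - μ) ∂P = 0 := by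
    intro i
    rw [integral_sub ((hd i).integrable one_le_two) (integrable_const _), hmean i]
    simp
  have hIdd : ∀ i j, Integrable (fun ω => (d i ω - μ) * (d j ω - μ)) P := fun i j =>
    (hd' i).integrable_mul (hd' j)
  have hIxx : ∀ i j, Integrable (fun ω => x i ω * x j ω) P := fun i j =>
    (hx i).integrable_mul (hx j)
  have hI : ∀ i j, IndepFun (fun ω => (d i ω - μ) * (d j ω - μ)) (fun ω => x i ω * x j ω) P := by
    intro i j
    exact hdx.comp (φ := fun v : ι → ℝ => (v i - μ) * (v j - μ)) (ψ := fun v : ι → ℝ => v i * v j)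
      (by fun_prop) (by fun_prop)
  have hexp : ∀ ω, (∑ i, (d i ω - μ) * x i ω) ^ 2 =
      ∑ i, ∑ j, ((d i ω - μ) * (d j ω - μ)) * (x i ω * x j ω) := by
    intro ω
    rw [sq, Finset.sum_mul_sum]
    exact Finset.sum_congr rfl fun i _ => Finset.sum_congr rfl fun j _ => by ring
  have hint : ∀ i j, Integrable
      (fun ω => ((d i ω - μ) * (d j ω - μ)) * (x i ω * x j ω)) P := fun i j =>
    (hI i j).integrable_mul (hIdd i j) (hIxx i j)
  simp only [hexp]
  refine ⟨integrable_finsetSum _ fun i _ => integrable_finsetSum _ fun j _ => hint i j, ?_⟩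
  rw [integral_finsetSum _ fun i _ => integrable_finsetSum _ fun j _ => hint i j, Finset.mul_sum]
  refine Finset.sum_congr rfl fun i _ => ?_
  rw [integral_finsetSum _ fun j _ => hint i j, Finset.sum_eq_single i]
  · rw [(hI i i).integral_fun_mul_eq_mul_integral (hIdd i i).aestronglyMeasurable
      (hIxx i i).aestronglyMeasurable]
    simp only [← sq]
    rw [← hvar i, variance_eq_integral (hdm i).aemeasurable, hmean i]
  -- Off the diagonal, the two centred factors are independent with mean zero, so the term vanishes
  -- whatever the dependence among the `x i`.
  · intro j _ hji
    rw [(hI i j).integral_fun_mul_eq_mul_integral (hIdd i j).aestronglyMeasurable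
      (hIxx i j).aestronglyMeasurable]
    have h1 : IndepFun (fun ω => d i ω - μ) (fun ω => d j ω - μ) P :=
      (hind.indepFun hji.symm).comp (φ := fun v : ℝ => v - μ) (ψ := fun v : ℝ => v - μ)
        (by fun_prop) (by fun_prop)
    rw [h1.integral_fun_mul_eq_mul_integral (hd' i).aestronglyMeasurable
      (hd' j).aestronglyMeasurable, h0 i]
    simp
  · simp

/-- A quantitative weak law of large numbers by truncation. -/
theorem lintegral_mean_sub_le {n : ℕ} (hn : 1 ≤ n) {u : Fin n → Ω → ℝ} {s M η C : ℝ}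
    (hM : 0 < M) (hη : 0 < η) (hum : ∀ i, Measurable (u i)) (hu0 : ∀ i ω, 0 ≤ u i ω)
    (hui : ∀ i, Integrable (u i) P) (hmean : ∀ i, ∫ ω, u i ω ∂P = s) (hind : iIndepFun u P)
    (hmi : ∀ i, Integrable (fun ω => u i ω ^ (1 + η)) P)
    (hmC : ∀ i, ∫ ω, u i ω ^ (1 + η) ∂P ≤ C) :
    ∫⁻ ω, ‖(n : ℝ)⁻¹ * ∑ i, u i ω - s‖ₑ ∂P ≤
      ENNReal.ofReal (2 * (C * M ^ (-η)) + (M ^ 2 + 1) * (√n)⁻¹) := by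
  have hn0 : (0 : ℝ) < n := by exact_mod_cast hn
  set τ := C * M ^ (-η) with hτ
  let v : Fin n → Ω → ℝ := fun i ω => min (u i ω) M
  have hvm : ∀ i, Measurable (v i) := fun i => (hum i).min measurable_const
  have hv0 : ∀ i ω, 0 ≤ v i ω := fun i ω => le_min (hu0 i ω) hM.le
  have hvM : ∀ i ω, v i ω ≤ M := fun i ω => min_le_right _ _
  have hvL : ∀ i, MemLp (v i) 2 P := fun i =>
    memLp_of_bounded (Eventually.of_forall fun ω => ⟨hv0 i ω, hvM i ω⟩)
      (hvm i).aestronglyMeasurable 2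
  have hvi : ∀ i, Integrable (v i) P := fun i => (hvL i).integrable one_le_two
  -- The truncation excess is nonzero only where u > M, and there 1 ≤ (u/M)^η.
  have hdiff : ∀ i ω, u i ω - v i ω ≤ u i ω ^ (1 + η) * M ^ (-η) := by
    intro i ω
    rcases le_total (u i ω) M with h | h
    · have : v i ω = u i ω := min_eq_left h
      rw [this, sub_self]
      have := hu0 i ω
      positivity
    · have hup : 0 < u i ω := hM.trans_le h
      have h1 : M ^ η ≤ u i ω ^ η := Real.rpow_le_rpow hM.le h hη.le
      have h2 : u i ω ≤ u i ω ^ (1 + η) * M ^ (-η) := by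
        rw [Real.rpow_add hup, Real.rpow_one, Real.rpow_neg hM.le, mul_assoc]
        refine le_mul_of_one_le_right hup.le ?_
        rw [← div_eq_mul_inv, one_le_div (by positivity)]
        exact h1
      linarith [hv0 i ω]
  have hdiff0 : ∀ i ω, 0 ≤ u i ω - v i ω := fun i ω => sub_nonneg.2 (min_le_left _ _)
  have hEdiff : ∀ i, ∫ ω, (u i ω - v i ω) ∂P ≤ τ := by
    intro i
    refine (integral_mono ((hui i).sub (hvi i)) ((hmi i).mul_const _) (hdiff i)).trans ?_
    rw [integral_mul_const]
    exact mul_le_mul_of_nonneg_right (hmC i) (by positivity)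
  have hvindep : iIndepFun v P :=
    hind.comp (fun _ x => min x M) fun _ => measurable_id.min measurable_const
  let m : Fin n → ℝ := fun i => ∫ ω, v i ω ∂P
  have hm : ∀ i, |s - m i| ≤ τ := by
    intro i
    have h1 : s - m i = ∫ ω, (u i ω - v i ω) ∂P := by
      rw [integral_sub (hui i) (hvi i), hmean i]
    rw [h1, abs_of_nonneg (integral_nonneg (hdiff0 i))]
    exact hEdiff i
  let V : Ω → ℝ := fun ω => ∑ i, (v i ω - m i)
  have hVsqi : Integrable (fun ω => V ω ^ 2) P :=
    (memLp_finsetSum Finset.univ fun i _ => (hvL i).sub (memLp_const (m i))).integrable_sq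
  have hVsq : ∫ ω, V ω ^ 2 ∂P ≤ n * M ^ 2 := by
    have h1 : ∫ ω, V ω ^ 2 ∂P = variance (∑ i, v i) P := by
      rw [variance_eq_integral (by fun_prop)]
      have h2 : ∫ ω, (∑ i, v i) ω ∂P = ∑ i, m i := by
        simp only [Finset.sum_apply]
        rw [integral_finsetSum _ fun i _ => hvi i]
      rw [h2]
      simp only [Finset.sum_apply, V, Finset.sum_sub_distrib]
    rw [h1, IndepFun.variance_sum (fun i _ => hvL i) fun i _ j _ hij => hvindep.indepFun hij]
    calc ∑ i, variance (v i) P ≤ ∑ _i : Fin n, M ^ 2 := by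
          refine Finset.sum_le_sum fun i _ => ?_
          refine (variance_le_expectation_sq (hvm i).aestronglyMeasurable).trans ?_
          calc ∫ ω, (v i ^ 2) ω ∂P ≤ ∫ _, M ^ 2 ∂P := by
                refine integral_mono (hvL i).integrable_sq (integrable_const _) fun ω => ?_
                exact pow_le_pow_left₀ (hv0 i ω) (hvM i ω) 2
            _ = M ^ 2 := by simp
      _ = n * M ^ 2 := by simp
  -- The fluctuation of the truncated mean is bounded by |x| ≤ x² + 1 with x = |V|/√n, so that only
  -- the variance of `V` is needed. The first summand is the truncation error and the final `τ` the
  -- bias of the truncated means.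
  let g : Ω → ℝ := fun ω => (n : ℝ)⁻¹ * ∑ i, (u i ω - v i ω) +
    ((√n)⁻¹ * ((n : ℝ)⁻¹ * V ω ^ 2) + (√n)⁻¹ * 1) + τ
  have hgi1 : Integrable (fun ω => (n : ℝ)⁻¹ * ∑ i, (u i ω - v i ω)) P :=
    (integrable_finsetSum _ fun i _ => (hui i).sub (hvi i)).const_mul _
  have hgi2 : Integrable (fun ω => (√n)⁻¹ * ((n : ℝ)⁻¹ * V ω ^ 2)) P :=
    (hVsqi.const_mul _).const_mul _
  have hgi3 : Integrable (fun ω => (√n)⁻¹ * ((n : ℝ)⁻¹ * V ω ^ 2) + (√n)⁻¹ * 1) P :=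
    hgi2.add (integrable_const _)
  have hgi13 : Integrable (fun ω => (n : ℝ)⁻¹ * ∑ i, (u i ω - v i ω) +
      ((√n)⁻¹ * ((n : ℝ)⁻¹ * V ω ^ 2) + (√n)⁻¹ * 1)) P := hgi1.add hgi3
  have hduv : ∀ i, Integrable (fun ω => u i ω - v i ω) P := fun i => (hui i).sub (hvi i)
  have hτ0 : 0 ≤ τ := (abs_nonneg _).trans (hm ⟨0, hn⟩)
  have hs0 : 0 < √(n : ℝ) := Real.sqrt_pos.2 hn0
  have hss : √(n : ℝ) * √(n : ℝ) = n := Real.mul_self_sqrt hn0.le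
  have hg0 : ∀ ω, 0 ≤ g ω := by
    intro ω
    have := Finset.sum_nonneg fun i (_ : i ∈ Finset.univ) => hdiff0 i ω
    positivity
  have hle : ∀ ω, |(n : ℝ)⁻¹ * ∑ i, u i ω - s| ≤ g ω := by
    intro ω
    have hdec : (n : ℝ)⁻¹ * ∑ i, u i ω - s = (n : ℝ)⁻¹ * ∑ i, (u i ω - v i ω) +
        (n : ℝ)⁻¹ * V ω + (n : ℝ)⁻¹ * ∑ i, (m i - s) := by
      simp only [V, Finset.sum_sub_distrib, Finset.sum_const, Finset.card_univ, Fintype.card_fin,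
        nsmul_eq_mul]
      field_simp
      ring
    have h1 : |(n : ℝ)⁻¹ * V ω| ≤ (√n)⁻¹ * ((n : ℝ)⁻¹ * V ω ^ 2) + (√n)⁻¹ * 1 := by
      have h2 : (√n)⁻¹ * ((n : ℝ)⁻¹ * V ω ^ 2) + (√n)⁻¹ * 1 =
          (√n)⁻¹ * (((√n)⁻¹ * |V ω|) ^ 2 + 1) := by
        rw [mul_pow, inv_pow, Real.sq_sqrt hn0.le, sq_abs]
        ring
      have h3 : |(n : ℝ)⁻¹ * V ω| = (√n)⁻¹ * ((√n)⁻¹ * |V ω|) := by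
        rw [abs_mul, abs_of_pos (inv_pos.2 hn0), ← mul_assoc, ← mul_inv, hss]
      rw [h2, h3]
      refine mul_le_mul_of_nonneg_left ?_ (by positivity)
      nlinarith [sq_nonneg ((√n)⁻¹ * |V ω| - 1), sq_nonneg ((√n)⁻¹ * |V ω|)]
    have h4 : |(n : ℝ)⁻¹ * ∑ i, (m i - s)| ≤ τ := by
      rw [abs_mul, abs_of_pos (inv_pos.2 hn0), inv_mul_le_iff₀ hn0]
      refine (Finset.abs_sum_le_sum_abs _ _).trans ?_
      calc ∑ i, |m i - s| ≤ ∑ _i : Fin n, τ :=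
            Finset.sum_le_sum fun i _ => by rw [abs_sub_comm]; exact hm i
        _ = n * τ := by simp
    have h5 : |(n : ℝ)⁻¹ * ∑ i, (u i ω - v i ω)| = (n : ℝ)⁻¹ * ∑ i, (u i ω - v i ω) := by
      refine abs_of_nonneg ?_
      have := Finset.sum_nonneg fun i (_ : i ∈ Finset.univ) => hdiff0 i ω
      positivity
    rw [hdec]
    refine (abs_add_three _ _ _).trans ?_
    simp only [g]
    linarith
  have hgi : Integrable g P := hgi13.add (integrable_const τ)
  calc ∫⁻ ω, ‖(n : ℝ)⁻¹ * ∑ i, u i ω - s‖ₑ ∂P ≤ ∫⁻ ω, ‖g ω‖ₑ ∂P := by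
        refine lintegral_mono fun ω => ?_
        rw [Real.enorm_eq_ofReal_abs, Real.enorm_eq_ofReal (hg0 ω)]
        exact ENNReal.ofReal_le_ofReal (hle ω)
    _ ≤ _ := by
      refine lintegral_enorm_le_of_integral_le hgi hg0 ?_
      have hEg : ∫ ω, g ω ∂P = (n : ℝ)⁻¹ * ∑ i, ∫ ω, (u i ω - v i ω) ∂P +
          ((√n)⁻¹ * ((n : ℝ)⁻¹ * ∫ ω, V ω ^ 2 ∂P) + (√n)⁻¹ * 1) + τ := by
        simp only [g]
        rw [integral_add hgi13 (integrable_const _), integral_add hgi1 hgi3,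
          integral_add hgi2 (integrable_const _), integral_const_mul, integral_const_mul,
          integral_const_mul, integral_finsetSum _ fun i _ => hduv i]
        simp
      have h6 : (n : ℝ)⁻¹ * ∑ i, ∫ ω, (u i ω - v i ω) ∂P ≤ τ := by
        rw [inv_mul_le_iff₀ hn0]
        calc ∑ i, ∫ ω, (u i ω - v i ω) ∂P ≤ ∑ _i : Fin n, τ :=
              Finset.sum_le_sum fun i _ => hEdiff i
          _ = n * τ := by simp
      have h7 : (n : ℝ)⁻¹ * ∫ ω, V ω ^ 2 ∂P ≤ M ^ 2 := by
        rw [inv_mul_le_iff₀ hn0]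
        exact hVsq
      have h8 := mul_le_mul_of_nonneg_left h7 (inv_pos.2 hs0).le
      rw [hEg]
      linarith

end Moments
end OLSArray

namespace OLSArray

/-! ### Characteristic function estimates -/

section CharFun

/-- For |x| ≤ 1 the cubic Taylor remainder suffices because p ≤ 3; for |x| ≥ 1 every term is crudely
dominated by |x|² because p ≥ 2. -/
theorem norm_exp_mul_I_sub_le {x p : ℝ} (hp2 : 2 ≤ p) (hp3 : p ≤ 3) :
    ‖Complex.exp (x * Complex.I) - (1 + x * Complex.I - x ^ 2 / 2)‖ ≤ 4 * |x| ^ p := by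
  rcases le_total |x| 1 with h | h
  · have h1 := Complex.norm_exp_sub_sum_le_norm_mul_exp (x * Complex.I) 3
    have hsum : ∑ m ∈ Finset.range 3, ((x : ℂ) * Complex.I) ^ m / (m.factorial : ℂ) =
        1 + x * Complex.I - x ^ 2 / 2 := by
      simp only [Finset.sum_range_succ, Finset.range_zero, Finset.sum_empty, pow_zero, pow_one,
        mul_pow, Complex.I_sq, Nat.factorial]
      push_cast
      ring
    have hn : ‖(x : ℂ) * Complex.I‖ = |x| := by simp
    rw [hsum, hn] at h1
    refine h1.trans ?_
    have h2 : |x| ^ 3 ≤ |x| ^ p := by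
      rcases (abs_nonneg x).eq_or_lt with h0 | h0
      · rw [← h0, Real.zero_rpow (by linarith)]
        norm_num
      · rw [← Real.rpow_natCast]
        exact Real.rpow_le_rpow_of_exponent_ge h0 h (by exact_mod_cast hp3)
    have h3 : Real.exp |x| ≤ 4 := by
      have := Real.exp_le_exp.2 h
      linarith [Real.exp_one_lt_three]
    calc |x| ^ 3 * Real.exp |x| ≤ |x| ^ p * 4 := by gcongr
      _ = 4 * |x| ^ p := mul_comm _ _
  · have h1 : ‖Complex.exp (x * Complex.I)‖ = 1 := Complex.norm_exp_ofReal_mul_I x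
    have h2 : ‖(1 : ℂ) + x * Complex.I - x ^ 2 / 2‖ ≤ 1 + |x| + |x| ^ 2 / 2 := by
      refine (norm_sub_le _ _).trans (add_le_add ((norm_add_le _ _).trans ?_) ?_)
      · simp
      · simp
    have h3 : |x| ^ 2 ≤ |x| ^ p := by
      rw [← Real.rpow_natCast]
      exact Real.rpow_le_rpow_of_exponent_le h (by exact_mod_cast hp2)
    refine (norm_sub_le _ _).trans ?_
    rw [h1]
    nlinarith

/-- With x = a²/2 the error is at most x² when x ≤ 1 and at most x when x ≥ 1. Both are below
x^(p/2), since 1 ≤ p/2 ≤ 2. -/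
theorem abs_exp_neg_half_sq_sub_le {a p : ℝ} (hp2 : 2 ≤ p) (hp3 : p ≤ 3) :
    |Real.exp (-(a ^ 2 / 2)) - (1 - a ^ 2 / 2)| ≤ |a| ^ p := by
  have hx : 0 ≤ a ^ 2 / 2 := by positivity
  have key : |Real.exp (-(a ^ 2 / 2)) - (1 - a ^ 2 / 2)| ≤ (a ^ 2 / 2) ^ (p / 2) := by
    rcases le_total (a ^ 2 / 2) 1 with h | h
    · have h1 := Real.abs_exp_sub_one_sub_id_le (x := -(a ^ 2 / 2)) (by rwa [abs_neg, abs_of_nonneg hx])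
      have h2 : (a ^ 2 / 2) ^ 2 ≤ (a ^ 2 / 2) ^ (p / 2) := by
        rcases hx.eq_or_lt with h0 | h0
        · rw [← h0, Real.zero_rpow (by linarith)]
          norm_num
        · rw [← Real.rpow_natCast (a ^ 2 / 2)]
          exact Real.rpow_le_rpow_of_exponent_ge h0 h (by push_cast; linarith)
      rw [neg_sq] at h1
      refine le_trans (le_of_eq ?_) (h1.trans h2)
      congr 1
      ring
    · have h2 : a ^ 2 / 2 ≤ (a ^ 2 / 2) ^ (p / 2) := by
        conv_lhs => rw [← Real.rpow_one (a ^ 2 / 2)]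
        exact Real.rpow_le_rpow_of_exponent_le h (by linarith)
      have h3 := Real.exp_pos (-(a ^ 2 / 2))
      have h4 : Real.exp (-(a ^ 2 / 2)) ≤ 1 := Real.exp_le_one_iff.2 (by linarith)
      rw [abs_le]
      constructor <;> linarith
  refine key.trans ?_
  calc (a ^ 2 / 2) ^ (p / 2) ≤ (|a| ^ (2 : ℝ)) ^ (p / 2) := by
        refine Real.rpow_le_rpow hx ?_ (by linarith)
        rw [Real.rpow_ofNat, sq_abs]
        linarith
    _ = |a| ^ p := by
        rw [← Real.rpow_mul (abs_nonneg a)]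
        congr 1
        ring

/-- The characteristic function of a standardized variable is close to the Gaussian one. -/
theorem norm_charFun_sub_exp_le {μ : Measure ℝ} [IsProbabilityMeasure μ] {p C : ℝ} (hp2 : 2 ≤ p)
    (hp3 : p ≤ 3) (hL : MemLp id 2 μ) (h1 : ∫ x, x ∂μ = 0) (h2 : ∫ x, x ^ 2 ∂μ = 1)
    (hi : Integrable (fun x => |x| ^ p) μ) (hC : ∫ x, |x| ^ p ∂μ ≤ C) (a : ℝ) :
    ‖charFun μ a - Real.exp (-(a ^ 2 / 2))‖ ≤ (4 * C + 1) * |a| ^ p := by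
  have hi1 : Integrable (fun x : ℝ => x) μ := hL.integrable one_le_two
  have hi2 : Integrable (fun x : ℝ => x ^ 2) μ := hL.integrable_sq
  have hJ1 : Integrable (fun x : ℝ => (((a * x : ℝ) : ℂ)) * Complex.I) μ :=
    ((hi1.const_mul a).ofReal).mul_const _
  have hJ2 : Integrable (fun x : ℝ => (((a * x : ℝ) : ℂ)) ^ 2 / 2) μ := by
    have : Integrable (fun x : ℝ => ((a ^ 2 / 2 * x ^ 2 : ℝ) : ℂ)) μ := (hi2.const_mul _).ofReal
    refine this.congr (Eventually.of_forall fun x => ?_)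
    push_cast
    ring
  have hJ01 : Integrable (fun x : ℝ => (1 : ℂ) + (((a * x : ℝ) : ℂ)) * Complex.I) μ :=
    (integrable_const _).add hJ1
  have hJ : Integrable
      (fun x : ℝ => 1 + (((a * x : ℝ) : ℂ)) * Complex.I - (((a * x : ℝ) : ℂ)) ^ 2 / 2) μ :=
    hJ01.sub hJ2
  have hE : Integrable (fun x : ℝ => Complex.exp (((a * x : ℝ) : ℂ) * Complex.I)) μ := by
    refine Integrable.of_bound (C := 1) (by fun_prop) (Eventually.of_forall fun x => ?_)
    rw [Complex.norm_exp_ofReal_mul_I]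
  have hval : ∫ x : ℝ, (1 + (((a * x : ℝ) : ℂ)) * Complex.I - (((a * x : ℝ) : ℂ)) ^ 2 / 2) ∂μ =
      ((1 - a ^ 2 / 2 : ℝ) : ℂ) := by
    rw [integral_sub hJ01 hJ2, integral_add (integrable_const _) hJ1, integral_mul_const,
      integral_complex_ofReal, integral_const_mul, h1]
    have : ∫ x : ℝ, (((a * x : ℝ) : ℂ)) ^ 2 / 2 ∂μ = ((a ^ 2 / 2 : ℝ) : ℂ) := by
      have h3 : ∀ x : ℝ, (((a * x : ℝ) : ℂ)) ^ 2 / 2 = ((a ^ 2 / 2 * x ^ 2 : ℝ) : ℂ) := by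
        intro x
        push_cast
        ring
      simp_rw [h3]
      rw [integral_complex_ofReal, integral_const_mul, h2, mul_one]
    rw [this]
    simp
  have hchar : charFun μ a = ∫ x : ℝ, Complex.exp (((a * x : ℝ) : ℂ) * Complex.I) ∂μ := by
    rw [charFun_apply_real]
    simp
  have hb : ‖charFun μ a - ((1 - a ^ 2 / 2 : ℝ) : ℂ)‖ ≤ 4 * C * |a| ^ p := by
    rw [hchar, ← hval, ← integral_sub hE hJ]
    refine (norm_integral_le_of_norm_le ((hi.const_mul (4 * |a| ^ p)))
      (Eventually.of_forall fun x => ?_)).trans ?_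
    · refine (norm_exp_mul_I_sub_le hp2 hp3).trans (le_of_eq ?_)
      rw [abs_mul, Real.mul_rpow (abs_nonneg _) (abs_nonneg _)]
      ring
    · rw [integral_const_mul]
      have : 0 ≤ |a| ^ p := Real.rpow_nonneg (abs_nonneg _) _
      nlinarith
  have hb2 : ‖((1 - a ^ 2 / 2 : ℝ) : ℂ) - (Real.exp (-(a ^ 2 / 2)) : ℂ)‖ ≤ |a| ^ p := by
    rw [← Complex.ofReal_sub, Complex.norm_real, Real.norm_eq_abs, abs_sub_comm]
    exact abs_exp_neg_half_sq_sub_le hp2 hp3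
  calc ‖charFun μ a - Real.exp (-(a ^ 2 / 2))‖ ≤ _ + _ := norm_sub_le_norm_sub_add_norm_sub _ _ _
    _ ≤ 4 * C * |a| ^ p + |a| ^ p := add_le_add hb hb2
    _ = _ := by ring

/-- Factors are exchanged one at a time; the untouched ones have norm at most one. -/
theorem norm_prod_sub_prod_le_sum {ι : Type*} (s : Finset ι) {f g : ι → ℂ}
    (hf : ∀ i, ‖f i‖ ≤ 1) (hg : ∀ i, ‖g i‖ ≤ 1) :
    ‖∏ i ∈ s, f i - ∏ i ∈ s, g i‖ ≤ ∑ i ∈ s, ‖f i - g i‖ := by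
  classical
  induction s using Finset.induction_on with
  | empty => simp
  | insert i s hi ih =>
    rw [Finset.prod_insert hi, Finset.prod_insert hi, Finset.sum_insert hi]
    have h1 : f i * ∏ j ∈ s, f j - g i * ∏ j ∈ s, g j =
        (f i - g i) * ∏ j ∈ s, f j + g i * (∏ j ∈ s, f j - ∏ j ∈ s, g j) := by ring
    have h2 : ‖∏ j ∈ s, f j‖ ≤ 1 := by
      rw [norm_prod]
      exact Finset.prod_le_one (fun _ _ => norm_nonneg _) fun j _ => hf j
    rw [h1]
    refine (norm_add_le _ _).trans (add_le_add ?_ ?_)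
    · rw [norm_mul]
      exact mul_le_of_le_one_right (norm_nonneg _) h2
    · rw [norm_mul]
      exact (mul_le_of_le_one_left (norm_nonneg _) (hg i)).trans ih

/-- The characteristic function of a randomly weighted sum of independent variables, computed
conditionally on the weights. -/
theorem integral_exp_sum_mul_eq {Ω : Type*} [MeasurableSpace Ω] {P : Measure Ω}
    [IsProbabilityMeasure P] {ι : Type*} [Fintype ι] {Y E : ι → Ω → ℝ}
    (hY : ∀ i, Measurable (Y i)) (hE : ∀ i, Measurable (E i)) (hind : iIndepFun Y P)
    (hYE : IndepFun (fun ω i => Y i ω) (fun ω i => E i ω) P) {a : (ι → ℝ) → ι → ℝ}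
    (ha : Measurable a) (t : ℝ) :
    ∫ ω, Complex.exp (((t * ∑ i, Y i ω * a (fun j => E j ω) i : ℝ) : ℂ) * Complex.I) ∂P =
      ∫ ω, ∏ i, charFun (P.map (Y i)) (t * a (fun j => E j ω) i) ∂P := by
  have hYv : Measurable (fun ω i => Y i ω) := measurable_pi_lambda _ hY
  have hEv : Measurable (fun ω i => E i ω) := measurable_pi_lambda _ hE
  have hmap := (indepFun_iff_map_prod_eq_prod_map_map hYv.aemeasurable hEv.aemeasurable).1 hYE
  have hpi := (iIndepFun_iff_map_fun_eq_pi_map fun i => (hY i).aemeasurable).1 hind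
  let F : (ι → ℝ) × (ι → ℝ) → ℂ := fun z =>
    Complex.exp (((t * ∑ i, z.1 i * a z.2 i : ℝ) : ℂ) * Complex.I)
  have hai : ∀ i, Measurable fun z : (ι → ℝ) × (ι → ℝ) => a z.2 i := fun i =>
    (measurable_pi_apply i).comp (ha.comp measurable_snd)
  have hF : Measurable F := by
    have : Measurable fun z : (ι → ℝ) × (ι → ℝ) => t * ∑ i, z.1 i * a z.2 i :=
      (Finset.measurable_sum _ fun i _ => (by fun_prop : Measurable fun z : (ι → ℝ) × (ι → ℝ) =>
        z.1 i).mul (hai i)).const_mul t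
    fun_prop
  have : ∀ i, IsProbabilityMeasure (P.map (Y i)) := fun i =>
    Measure.isProbabilityMeasure_map (hY i).aemeasurable
  have : IsProbabilityMeasure (P.map fun ω i => Y i ω) :=
    Measure.isProbabilityMeasure_map hYv.aemeasurable
  have : IsProbabilityMeasure (P.map fun ω i => E i ω) :=
    Measure.isProbabilityMeasure_map hEv.aemeasurable
  have hFi : Integrable F ((P.map fun ω i => Y i ω).prod (P.map fun ω i => E i ω)) := by
    refine Integrable.of_bound (C := 1) hF.aestronglyMeasurable (Eventually.of_forall fun z => ?_)
    rw [Complex.norm_exp_ofReal_mul_I]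
  have h1 : ∫ ω, F ((fun i => Y i ω), fun i => E i ω) ∂P =
      ∫ z, F z ∂((P.map fun ω i => Y i ω).prod (P.map fun ω i => E i ω)) := by
    rw [← hmap, integral_map (hYv.prodMk hEv).aemeasurable hF.aestronglyMeasurable]
  -- With the weights frozen at `e`, the exponential factorizes over the coordinates and the product
  -- law of `Y` turns the integral into a product.
  have h2 : ∀ e : ι → ℝ, ∫ y, F (y, e) ∂(P.map fun ω i => Y i ω) =
      ∏ i, charFun (P.map (Y i)) (t * a e i) := by
    intro e
    rw [hpi]
    have h3 : ∀ y : ι → ℝ, F (y, e) =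
        ∏ i, Complex.exp (((t * a e i : ℝ) : ℂ) * (y i : ℂ) * Complex.I) := by
      intro y
      rw [← Complex.exp_sum]
      simp only [F]
      congr 1
      push_cast
      rw [Finset.mul_sum, Finset.sum_mul]
      exact Finset.sum_congr rfl fun i _ => by ring
    simp_rw [h3]
    rw [integral_fintype_prod_eq_prod
      (fun i (x : ℝ) => Complex.exp (((t * a e i : ℝ) : ℂ) * (x : ℂ) * Complex.I))]
    simp only [charFun_apply_real]
  have hmeas : Measurable fun e : ι → ℝ => ∏ i, charFun (P.map (Y i)) (t * a e i) := by
    refine Finset.measurable_prod _ fun i _ => ?_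
    exact (continuous_charFun.measurable).comp
      (((measurable_pi_apply i).comp ha).const_mul t)
  calc _ = ∫ ω, F ((fun i => Y i ω), fun i => E i ω) ∂P := rfl
    _ = ∫ e, ∏ i, charFun (P.map (Y i)) (t * a e i) ∂(P.map fun ω i => E i ω) := by
      rw [h1, integral_prod_symm F hFi]
      simp_rw [h2]
    _ = _ := by rw [integral_map hEv.aemeasurable hmeas.aestronglyMeasurable]

end CharFun

/-! ### From convergence in probability to convergence in distribution -/

section Convergence

variable {Ω : ℕ → Type*} [∀ n, MeasurableSpace (Ω n)] {P : ∀ n, Measure (Ω n)}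
  [∀ n, IsProbabilityMeasure (P n)]

/-- Bounded convergence: the integrand is below η/2 outside an event of vanishing probability, and
below |B| on it. -/
theorem IsLittleOP.tendsto_integral {F : ∀ n, Ω n → ℝ} (hF : IsLittleOP P F)
    (hm : ∀ n, Measurable (F n)) (h0 : ∀ n ω, 0 ≤ F n ω) {B : ℝ} (hB : ∀ n ω, F n ω ≤ B) :
    Tendsto (fun n => ∫ ω, F n ω ∂(P n)) atTop (𝓝 0) := by
  have hint : ∀ n, Integrable (F n) (P n) := fun n =>
    Integrable.of_bound (C := B) (hm n).aestronglyMeasurable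
      (Eventually.of_forall fun ω => by rw [Real.norm_of_nonneg (h0 n ω)]; exact hB n ω)
  rw [Metric.tendsto_atTop']
  intro η hη
  have h1 := (ENNReal.tendsto_toReal ENNReal.zero_ne_top).comp (hF (η / 2) (half_pos hη))
  have h2 := h1.const_mul |B|
  simp only [ENNReal.toReal_zero, mul_zero] at h2
  obtain ⟨N, hN⟩ := eventually_atTop.1 (h2.eventually_lt_const (half_pos hη))
  refine ⟨N, fun n hn => ?_⟩
  have hset : MeasurableSet {ω | η / 2 ≤ |F n ω|} :=
    measurableSet_le measurable_const (hm n).abs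
  have hle : ∀ ω, F n ω ≤ η / 2 + {ω | η / 2 ≤ |F n ω|}.indicator (fun _ => |B|) ω := by
    intro ω
    by_cases h : η / 2 ≤ |F n ω|
    · rw [Set.indicator_of_mem (by exact h)]
      linarith [hB n ω, le_abs_self B]
    · rw [Set.indicator_of_notMem (by exact h)]
      rw [abs_of_nonneg (h0 n ω)] at h
      linarith
  have hle2 := integral_mono (hint n)
    ((integrable_const (η / 2)).add ((integrable_const |B|).indicator hset)) hle
  rw [integral_add' (integrable_const _) ((integrable_const |B|).indicator hset),
    integral_indicator_const _ hset] at hle2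
  simp only [integral_const, probReal_univ, smul_eq_mul] at hle2
  have h3 := hN n hn.le
  rw [Real.dist_eq, sub_zero, abs_of_nonneg (integral_nonneg (h0 n))]
  simp only [Function.comp, ← Measure.real_def] at h3
  linarith [mul_comm |B| ((P n).real {ω | η / 2 ≤ |F n ω|})]

/-- Convergence in distribution to a Gaussian from characteristic functions, up to an error that
vanishes in probability. -/
theorem tendstoInDistribution_gaussian_of_isLittleOP {T Z : ∀ n, Ω n → ℝ}
    (hT : ∀ n, Measurable (T n)) (hZ : ∀ n, Measurable (Z n))
    (hTZ : IsLittleOP P fun n ω => T n ω - Z n ω)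
    (hchar : ∀ t : ℝ, Tendsto
      (fun n => ∫ ω, Complex.exp (((t * Z n ω : ℝ) : ℂ) * Complex.I) ∂(P n)) atTop
      (𝓝 (Real.exp (-(t ^ 2 / 2)) : ℂ))) :
    TendstoInDistribution T atTop (id : ℝ → ℝ) P (gaussianReal 0 1) where
  forall_aemeasurable n := (hT n).aemeasurable
  tendsto := by
    refine ProbabilityMeasure.tendsto_iff_tendsto_charFun.2 fun t => ?_
    have hlim : charFun ((gaussianReal 0 1).map id) t = (Real.exp (-(t ^ 2 / 2)) : ℂ) := by
      rw [Measure.map_id, charFun_gaussianReal]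
      push_cast
      congr 1
      simp
    have hcT : ∀ n, charFun ((P n).map (T n)) t =
        ∫ ω, Complex.exp (((t * T n ω : ℝ) : ℂ) * Complex.I) ∂(P n) := by
      intro n
      rw [charFun_apply_real, integral_map (hT n).aemeasurable (by fun_prop)]
      simp
    simp only [ProbabilityMeasure.coe_mk, hlim, hcT]
    have hint : ∀ {X : ∀ n, Ω n → ℝ}, (∀ n, Measurable (X n)) → ∀ n,
        Integrable (fun ω => Complex.exp (((t * X n ω : ℝ) : ℂ) * Complex.I)) (P n) := by
      intro X hX n
      have := hX n
      refine Integrable.of_bound (C := 1)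
        (by fun_prop : Measurable _).aestronglyMeasurable (Eventually.of_forall fun ω => ?_)
      rw [Complex.norm_exp_ofReal_mul_I]
    let F : ∀ n, Ω n → ℝ := fun n ω =>
      ‖Complex.exp (((t * T n ω : ℝ) : ℂ) * Complex.I) -
        Complex.exp (((t * Z n ω : ℝ) : ℂ) * Complex.I)‖
    have hFop : IsLittleOP P F := by
      refine (hTZ.const_mul t).of_le (HighProb.of_eventually (Eventually.of_forall fun n =>
        Eventually.of_forall fun ω => ?_))
      have h1 : Complex.exp (((t * T n ω : ℝ) : ℂ) * Complex.I) -
          Complex.exp (((t * Z n ω : ℝ) : ℂ) * Complex.I) =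
          Complex.exp (((t * Z n ω : ℝ) : ℂ) * Complex.I) *
            (Complex.exp (Complex.I * ((t * (T n ω - Z n ω) : ℝ) : ℂ)) - 1) := by
        rw [mul_sub, mul_one, ← Complex.exp_add]
        congr 2
        push_cast
        ring
      simp only [F, abs_norm]
      rw [h1, norm_mul, Complex.norm_exp_ofReal_mul_I, one_mul]
      exact Real.norm_exp_I_mul_ofReal_sub_one_le
    have hFint := hFop.tendsto_integral (B := 2)
      (fun n => by have := hT n; have := hZ n; fun_prop) (fun n ω => norm_nonneg _) (fun n ω => by
        refine (norm_sub_le _ _).trans ?_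
        rw [Complex.norm_exp_ofReal_mul_I, Complex.norm_exp_ofReal_mul_I]
        norm_num)
    have hdiff : Tendsto (fun n => ∫ ω, Complex.exp (((t * T n ω : ℝ) : ℂ) * Complex.I) ∂(P n) -
        ∫ ω, Complex.exp (((t * Z n ω : ℝ) : ℂ) * Complex.I) ∂(P n)) atTop (𝓝 0) := by
      refine squeeze_zero_norm (fun n => ?_) hFint
      rw [← integral_sub (hint hT n) (hint hZ n)]
      exact norm_integral_le_integral_norm _
    simpa using hdiff.add (hchar t)

end Convergence
end OLSArray

namespace OLSArray

/-! ### Limit theorems for triangular arrays -/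

section ArrayLimits

variable {Ω : ℕ → Type*} [∀ n, MeasurableSpace (Ω n)] {P : ∀ n, Measure (Ω n)}
  [∀ n, IsProbabilityMeasure (P n)] {d ε : ∀ n, Fin n → Ω n → ℝ} {μ s : ℕ → ℝ}
  {K p q r : ℝ}

/-- Weak law of large numbers for the sample variance of a triangular array. -/
theorem isLittleOP_mean_sq_sub (hK : 0 < K) (hp2 : 2 < p) (hpq : p ≤ q)
    (hdm : ∀ n i, Measurable (d n i)) (hind : ∀ n, iIndepFun (d n) (P n))
    (hmean : ∀ n i, ∫ ω, d n i ω ∂(P n) = μ n) (hvar : ∀ n i, variance (d n i) (P n) = s n)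
    (hmom : ∀ n i, ∫⁻ ω, ‖d n i ω‖ₑ ^ q ∂(P n) ≤ ENNReal.ofReal K) :
    IsLittleOP P fun n ω => (n : ℝ)⁻¹ * ∑ i, (d n i ω - μ n) ^ 2 - s n := by
  set C := centeredMomentBound p K
  have hη : 0 < p / 2 - 1 := by linarith
  -- The truncation level must diverge with M²/√n → 0; the exponent 1/8 gives M²/√n = n^(-1/4).
  let M : ℕ → ℝ := fun n => (n : ℝ) ^ (1 / 8 : ℝ)
  have hnat : Tendsto (fun n : ℕ => (n : ℝ)) atTop atTop := tendsto_natCast_atTop_atTop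
  have hMt : Tendsto M atTop atTop := (tendsto_rpow_atTop (by norm_num)).comp hnat
  have hc : Tendsto (fun n : ℕ => 2 * (C * M n ^ (-(p / 2 - 1))) + (M n ^ 2 + 1) * (√n)⁻¹) atTop
      (𝓝 0) := by
    have h1 : Tendsto (fun n => M n ^ (-(p / 2 - 1))) atTop (𝓝 0) :=
      (tendsto_rpow_neg_atTop hη).comp hMt
    have h2 : Tendsto (fun n : ℕ => (√n)⁻¹) atTop (𝓝 0) :=
      tendsto_inv_atTop_zero.comp (Real.tendsto_sqrt_atTop.comp hnat)
    have h3 : Tendsto (fun n : ℕ => M n ^ 2 * (√n)⁻¹) atTop (𝓝 0) := by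
      have h4 : Tendsto (fun n : ℕ => (n : ℝ) ^ (-(1 / 4 : ℝ))) atTop (𝓝 0) :=
        (tendsto_rpow_neg_atTop (by norm_num)).comp hnat
      refine h4.congr' ?_
      filter_upwards [eventually_gt_atTop 0] with n hn
      have hn0 : (0 : ℝ) < n := by exact_mod_cast hn
      simp only [M]
      rw [Real.sqrt_eq_rpow, ← Real.rpow_neg hn0.le, ← Real.rpow_mul_natCast hn0.le,
        ← Real.rpow_add hn0]
      norm_num
    have h5 := ((h1.const_mul C).const_mul 2).add (h3.add h2)
    simp only [mul_zero, add_zero] at h5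
    refine h5.congr fun n => ?_
    ring
  refine IsLittleOP.of_lintegral_le (fun n => ?_) hc ?_
  · have := hdm n
    fun_prop
  filter_upwards [eventually_ge_atTop 1, hMt.eventually_gt_atTop 0] with n hn hM
  have hL : ∀ i, MemLp (d n i) 2 (P n) := fun i =>
    (memLp_two_of_lintegral_le (hdm n i) (hp2.le.trans hpq) hK.le (hmom n i)).1
  have hcm : ∀ i, Integrable (fun ω => ((d n i ω - μ n) ^ 2) ^ (1 + (p / 2 - 1))) (P n) ∧
      ∫ ω, ((d n i ω - μ n) ^ 2) ^ (1 + (p / 2 - 1)) ∂(P n) ≤ C := by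
    intro i
    have h := centered_moment_le (hdm n i) (by linarith : 1 ≤ p) hpq hK.le (hmom n i)
    have heq : ∀ ω, ((d n i ω - μ n) ^ 2) ^ (1 + (p / 2 - 1)) = |d n i ω - μ n| ^ p := by
      intro ω
      rw [← sq_abs, ← Real.rpow_natCast_mul (abs_nonneg _)]
      congr 1
      push_cast
      ring
    simp only [heq]
    rwa [hmean] at h
  refine lintegral_mean_sub_le hn hM hη (fun i => ?_) (fun i ω => sq_nonneg _) (fun i => ?_)
    (fun i => ?_) ?_ (fun i => (hcm i).1) (fun i => (hcm i).2)
  · have := hdm n i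
    fun_prop
  · exact ((hL i).sub (memLp_const (μ n))).integrable_sq
  · rw [← hvar n i, variance_eq_integral (hdm n i).aemeasurable, hmean]
  · exact (hind n).comp (fun _ x => (x - μ n) ^ 2) fun _ => by fun_prop

theorem tendsto_inv_sqrt_rpow_mul (hp2 : 2 < p) :
    Tendsto (fun n : ℕ => ((√n)⁻¹) ^ p * n) atTop (𝓝 0) := by
  have h : Tendsto (fun n : ℕ => (n : ℝ) ^ (-(p / 2 - 1))) atTop (𝓝 0) :=
    (tendsto_rpow_neg_atTop (by linarith)).comp tendsto_natCast_atTop_atTop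
  refine h.congr' ?_
  filter_upwards [eventually_gt_atTop 0] with n hn
  have hn0 : (0 : ℝ) < n := by exact_mod_cast hn
  rw [Real.sqrt_eq_rpow, ← Real.rpow_neg hn0.le, ← Real.rpow_mul hn0.le]
  conv_rhs => rw [← Real.rpow_one (n : ℝ)]
  rw [← Real.rpow_mul hn0.le, ← Real.rpow_add hn0]
  congr 1
  ring

/-- The characteristic functions of the self-normalized weighted sums converge. -/
theorem tendsto_integral_exp_weighted_sum (hK : 0 < K) (hp2 : 2 < p) (hp3 : p ≤ 3) (hpq : p ≤ q)
    (hpr : p ≤ r) (hdm : ∀ n i, Measurable (d n i)) (hεm : ∀ n i, Measurable (ε n i))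
    (hind : ∀ n, iIndepFun (d n) (P n)) (hmean : ∀ n i, ∫ ω, d n i ω ∂(P n) = μ n)
    (hvar : ∀ n i, variance (d n i) (P n) = s n) (hs : ∀ n, 1 ≤ n → K⁻¹ ≤ s n)
    (hmom : ∀ n i, ∫⁻ ω, ‖d n i ω‖ₑ ^ q ∂(P n) ≤ ENNReal.ofReal K)
    (hdε : ∀ n, IndepFun (fun ω i => d n i ω) (fun ω i => ε n i ω) (P n))
    (hεmom : ∀ n i, ∫⁻ ω, ‖ε n i ω‖ₑ ^ r ∂(P n) ≤ ENNReal.ofReal K)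
    (hlow : HighProb P fun n ω => (2 * K)⁻¹ ≤ (n : ℝ)⁻¹ * ∑ i, ε n i ω ^ 2) (t : ℝ) :
    Tendsto (fun n => ∫ ω, Complex.exp (((t * ∑ i, ((d n i ω - μ n) / √(s n)) *
      (ε n i ω / √(∑ j, ε n j ω ^ 2)) : ℝ) : ℂ) * Complex.I) ∂(P n)) atTop
      (𝓝 (Real.exp (-(t ^ 2 / 2)) : ℂ)) := by
  -- Standardizing divides by √s, and s ≥ 1/K costs at most the factor (√K)^p in the p-th moment.
  set C := centeredMomentBound p K * √K ^ p with hC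
  have hC0 : 0 ≤ C := by
    have := centeredMomentBound_nonneg (p := p) hK.le
    positivity
  have hp0 : 0 < p := by linarith
  let Y : ∀ n, Fin n → Ω n → ℝ := fun n i ω => (d n i ω - μ n) / √(s n)
  let a : ∀ n, (Fin n → ℝ) → Fin n → ℝ := fun n e i => e i / √(∑ j, e j ^ 2)
  have hYm : ∀ n i, Measurable (Y n i) := fun n i => by
    have := hdm n i
    fun_prop
  have ham : ∀ n, Measurable (a n) := fun n => by
    refine measurable_pi_lambda _ fun i => ?_
    fun_prop
  have hYind : ∀ n, iIndepFun (Y n) (P n) := fun n =>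
    (hind n).comp (fun _ x => (x - μ n) / √(s n)) fun _ => by fun_prop
  have hYε : ∀ n, IndepFun (fun ω i => Y n i ω) (fun ω i => ε n i ω) (P n) := fun n =>
    (hdε n).comp (φ := fun v i => (v i - μ n) / √(s n)) (ψ := id)
      (measurable_pi_lambda _ fun i => by fun_prop) measurable_id
  have hprob : ∀ n i, IsProbabilityMeasure ((P n).map (Y n i)) := fun n i =>
    Measure.isProbabilityMeasure_map (hYm n i).aemeasurable
  have hchar : ∀ n i, ∀ u : ℝ,
      ‖charFun ((P n).map (Y n i)) u - Real.exp (-(u ^ 2 / 2))‖ ≤ (4 * C + 1) * |u| ^ p := by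
    intro n i u
    have hsn : K⁻¹ ≤ s n := hs n (i.pos)
    have hsp : 0 < s n := (inv_pos.2 hK).trans_le hsn
    have hss : 0 < √(s n) := Real.sqrt_pos.2 hsp
    have hL : MemLp (d n i) 2 (P n) :=
      (memLp_two_of_lintegral_le (hdm n i) (hp2.le.trans hpq) hK.le (hmom n i)).1
    have hLY : MemLp (Y n i) 2 (P n) := by
      have := (hL.sub (memLp_const (μ n))).mul_const (√(s n))⁻¹
      exact this
    have hcm := centered_moment_le (hdm n i) (by linarith : 1 ≤ p) hpq hK.le (hmom n i)
    rw [hmean] at hcm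
    have hYp : ∀ ω, |Y n i ω| ^ p = |d n i ω - μ n| ^ p * ((√(s n))⁻¹) ^ p := by
      intro ω
      simp only [Y]
      rw [div_eq_mul_inv, abs_mul, abs_of_pos (inv_pos.2 hss),
        Real.mul_rpow (abs_nonneg _) (inv_pos.2 hss).le]
    have hsK : (√(s n))⁻¹ ≤ √K := by
      rw [← Real.sqrt_inv]
      refine Real.sqrt_le_sqrt ?_
      rw [inv_le_comm₀ hsp hK]
      exact hsn
    have hpm : AEStronglyMeasurable (fun x : ℝ => |x| ^ p) ((P n).map (Y n i)) :=
      (by fun_prop : Measurable fun x : ℝ => |x| ^ p).aestronglyMeasurable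
    refine norm_charFun_sub_exp_le hp2.le hp3 ?_ ?_ ?_ ?_ ?_ u
    · rw [memLp_map_measure_iff (by fun_prop) (hYm n i).aemeasurable]
      exact hLY
    · rw [integral_map (hYm n i).aemeasurable (by fun_prop)]
      simp only [Y]
      rw [integral_div, integral_sub (hL.integrable one_le_two) (integrable_const _), hmean]
      simp
    · rw [integral_map (hYm n i).aemeasurable (by fun_prop)]
      simp only [Y, div_pow]
      rw [integral_div, Real.sq_sqrt hsp.le, ← hmean n i,
        ← variance_eq_integral (hdm n i).aemeasurable, hvar, div_self hsp.ne']
    · rw [integrable_map_measure hpm (hYm n i).aemeasurable]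
      refine (hcm.1.mul_const (((√(s n))⁻¹) ^ p)).congr (Eventually.of_forall fun ω => ?_)
      exact (hYp ω).symm
    · rw [integral_map (hYm n i).aemeasurable hpm]
      simp_rw [hYp]
      rw [integral_mul_const]
      have := centeredMomentBound_nonneg (p := p) hK.le
      exact mul_le_mul hcm.2 (Real.rpow_le_rpow (inv_pos.2 hss).le hsK hp0.le) (by positivity) this
  let F : ∀ n, Ω n → ℝ := fun n ω =>
    ‖∏ i, charFun ((P n).map (Y n i)) (t * a n (fun j => ε n j ω) i) -
      (Real.exp (-(t ^ 2 / 2)) : ℂ)‖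
  -- The Lyapunov sum: once Σε² ≥ n/(2K), it controls the sum of |weight|^p up to a constant. Its
  -- mean is O(n^(1-p/2)), without any independence among the errors.
  let G : ∀ n, Ω n → ℝ := fun n ω => ((√n)⁻¹) ^ p * ∑ i, |ε n i ω| ^ p
  have hεp : ∀ n i, Integrable (fun ω => |ε n i ω| ^ p) (P n) ∧
      ∫ ω, |ε n i ω| ^ p ∂(P n) ≤ 1 + K := fun n i =>
    integrable_rpow_of_lintegral_le (hεm n i) hp0 hpr hK.le (hεmom n i)
  have hG : IsLittleOP P G := by
    have hc := (tendsto_inv_sqrt_rpow_mul hp2).mul_const (1 + K)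
    rw [zero_mul] at hc
    refine IsLittleOP.of_lintegral_le (fun n => ?_) hc (Eventually.of_forall fun n => ?_)
    · have := hεm n
      exact (by fun_prop : Measurable _).aemeasurable
    · refine lintegral_enorm_le_of_integral_le
        ((integrable_finsetSum _ fun i _ => (hεp n i).1).const_mul _) (fun ω => by positivity) ?_
      rw [integral_const_mul, integral_finsetSum _ fun i _ => (hεp n i).1, mul_assoc]
      refine mul_le_mul_of_nonneg_left ?_ (by positivity)
      calc ∑ i, ∫ ω, |ε n i ω| ^ p ∂(P n) ≤ ∑ _i : Fin n, (1 + K) :=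
            Finset.sum_le_sum fun i _ => (hεp n i).2
        _ = n * (1 + K) := by
            rw [Finset.sum_const, Finset.card_univ, Fintype.card_fin, nsmul_eq_mul]
  have hF : IsLittleOP P F := by
    refine (hG.const_mul ((4 * C + 1) * (|t| * √(2 * K)) ^ p)).of_le (hlow.mono ?_)
    filter_upwards [eventually_ge_atTop 1] with n hn
    refine Eventually.of_forall fun ω hω => ?_
    have hn0 : (0 : ℝ) < n := by exact_mod_cast hn
    set E := ∑ j, ε n j ω ^ 2 with hE
    have hE1 : (2 * K)⁻¹ * n ≤ E := by
      rwa [← div_eq_inv_mul, le_div_iff₀ hn0] at hω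
    have hEpos : 0 < E := lt_of_lt_of_le (by positivity) hE1
    have hsE : (√E)⁻¹ ≤ √(2 * K) * (√n)⁻¹ := by
      rw [← Real.sqrt_inv, ← Real.sqrt_inv, ← Real.sqrt_mul (by positivity)]
      refine Real.sqrt_le_sqrt ?_
      rw [inv_le_comm₀ hEpos (by positivity), mul_inv, inv_inv]
      exact hE1
    have hsum : ∑ i, a n (fun j => ε n j ω) i ^ 2 = 1 := by
      simp only [a, div_pow]
      rw [← Finset.sum_div, Real.sq_sqrt hEpos.le, div_self hEpos.ne']
    -- Because the squared weights sum to one, the Gaussian limit splits into as many factors as the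
    -- conditional characteristic function, to be compared factor by factor.
    have hexp : (Real.exp (-(t ^ 2 / 2)) : ℂ) =
        ∏ i, (Real.exp (-((t * a n (fun j => ε n j ω) i) ^ 2 / 2)) : ℂ) := by
      rw [← Complex.ofReal_prod, ← Real.exp_sum]
      congr 2
      simp only [mul_pow]
      rw [Finset.sum_neg_distrib, ← Finset.sum_div, ← Finset.mul_sum, hsum, mul_one]
    have hFle : F n ω ≤ ∑ i, (4 * C + 1) * |t * a n (fun j => ε n j ω) i| ^ p := by
      simp only [F]
      rw [hexp]
      refine (norm_prod_sub_prod_le_sum _ (fun i => norm_charFun_le_one _) fun i => ?_).trans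
        (Finset.sum_le_sum fun i _ => hchar n i _)
      rw [Complex.norm_real, Real.norm_of_nonneg (Real.exp_pos _).le, Real.exp_le_one_iff]
      have := sq_nonneg (t * a n (fun j => ε n j ω) i)
      linarith
    have hterm : ∀ i, |t * a n (fun j => ε n j ω) i| ^ p ≤
        (|t| * √(2 * K)) ^ p * (((√n)⁻¹) ^ p * |ε n i ω| ^ p) := by
      intro i
      rw [← Real.mul_rpow (by positivity) (abs_nonneg _),
        ← Real.mul_rpow (by positivity) (by positivity)]
      refine Real.rpow_le_rpow (abs_nonneg _) ?_ hp0.le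
      simp only [a]
      rw [abs_mul, abs_div, abs_of_nonneg (Real.sqrt_nonneg _), div_eq_mul_inv]
      calc |t| * (|ε n i ω| * (√E)⁻¹) ≤ |t| * (|ε n i ω| * (√(2 * K) * (√n)⁻¹)) := by gcongr
        _ = _ := by ring
    have hFG : F n ω ≤ (4 * C + 1) * (|t| * √(2 * K)) ^ p * G n ω := by
      refine hFle.trans ?_
      calc ∑ i, (4 * C + 1) * |t * a n (fun j => ε n j ω) i| ^ p
          ≤ ∑ i, (4 * C + 1) * ((|t| * √(2 * K)) ^ p * (((√n)⁻¹) ^ p * |ε n i ω| ^ p)) := by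
            refine Finset.sum_le_sum fun i _ => ?_
            exact mul_le_mul_of_nonneg_left (hterm i) (by positivity)
        _ = _ := by
            simp only [G, ← Finset.mul_sum]
            ring
    rw [abs_of_nonneg (norm_nonneg _)]
    exact hFG.trans (le_abs_self _)
  have hprodm : ∀ n, Measurable fun ω =>
      ∏ i, charFun ((P n).map (Y n i)) (t * a n (fun j => ε n j ω) i) := by
    intro n
    refine Finset.measurable_prod _ fun i _ => continuous_charFun.measurable.comp ?_
    exact ((measurable_pi_apply i).comp
      ((ham n).comp (measurable_pi_lambda _ (hεm n)))).const_mul t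
  have hprod1 : ∀ n ω,
      ‖∏ i, charFun ((P n).map (Y n i)) (t * a n (fun j => ε n j ω) i)‖ ≤ 1 := by
    intro n ω
    rw [norm_prod]
    exact Finset.prod_le_one (fun _ _ => norm_nonneg _) fun i _ => norm_charFun_le_one _
  have hFint := hF.tendsto_integral (B := 2)
    (fun n => ((hprodm n).sub measurable_const).norm) (fun n ω => norm_nonneg _) (fun n ω => by
      refine (norm_sub_le _ _).trans ?_
      rw [Complex.norm_real, Real.norm_of_nonneg (Real.exp_pos _).le]
      have h1 : Real.exp (-(t ^ 2 / 2)) ≤ 1 := Real.exp_le_one_iff.2 (by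
        have := sq_nonneg t
        linarith)
      linarith [hprod1 n ω])
  rw [tendsto_iff_norm_sub_tendsto_zero]
  refine squeeze_zero (fun _ => norm_nonneg _) (fun n => ?_) hFint
  have h1 := integral_exp_sum_mul_eq (hYm n) (hεm n) (hYind n) (hYε n) (ham n) t
  have h2 : Integrable (fun ω =>
      ∏ i, charFun ((P n).map (Y n i)) (t * a n (fun j => ε n j ω) i)) (P n) :=
    Integrable.of_bound (C := 1) (hprodm n).aestronglyMeasurable
      (Eventually.of_forall fun ω => hprod1 n ω)
  calc _ = ‖∫ ω, ∏ i, charFun ((P n).map (Y n i)) (t * a n (fun j => ε n j ω) i) ∂(P n) -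
        (Real.exp (-(t ^ 2 / 2)) : ℂ)‖ := by rw [← h1]
    _ = ‖∫ ω, (∏ i, charFun ((P n).map (Y n i)) (t * a n (fun j => ε n j ω) i) -
        (Real.exp (-(t ^ 2 / 2)) : ℂ)) ∂(P n)‖ := by
      rw [integral_sub h2 (integrable_const _)]
      simp
    _ ≤ _ := norm_integral_le_integral_norm _

theorem sum_div_mul_div_eq {n : ℕ} (hn : 1 ≤ n) (x e : Fin n → ℝ) {v : ℝ} (hv : 0 ≤ v) :
    ∑ i, x i / √v * (e i / √(∑ j, e j ^ 2)) =
      (√n)⁻¹ * (∑ i, x i * e i) * (√(v * ((n : ℝ)⁻¹ * ∑ j, e j ^ 2)))⁻¹ := by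
  have hn0 : (0 : ℝ) < n := by exact_mod_cast hn
  have hs : √(n : ℝ) ≠ 0 := (Real.sqrt_pos.2 hn0).ne'
  rw [Real.sqrt_mul hv, Real.sqrt_mul (inv_pos.2 hn0).le, Real.sqrt_inv, mul_inv, mul_inv, inv_inv]
  have h1 : (√(n : ℝ))⁻¹ * (∑ i, x i * e i) * ((√v)⁻¹ * (√n * (√(∑ j, e j ^ 2))⁻¹)) =
      (∑ i, x i * e i) * ((√v)⁻¹ * (√(∑ j, e j ^ 2))⁻¹) := by
    field_simp
  rw [h1, Finset.sum_mul]
  refine Finset.sum_congr rfl fun i _ => ?_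
  simp only [div_eq_mul_inv]
  ring

end ArrayLimits
end OLSArray

namespace OLSArray

/-! ### Slutsky arguments with moving centres -/

section Studentization

variable {Ω : ℕ → Type*} [∀ n, MeasurableSpace (Ω n)] {P : ∀ n, Measure (Ω n)}

theorem IsLittleOP.isBoundedOP_of_sub {X : ∀ n, Ω n → ℝ} {x : ℕ → ℝ} {B : ℝ}
    (hX : IsLittleOP P fun n ω => X n ω - x n) (hx : ∀ᶠ n in atTop, |x n| ≤ B) :
    IsBoundedOP P X := by
  refine (hX.isBoundedOP.add (IsBoundedOP.of_bounded hx)).of_le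
    (HighProb.of_eventually (Eventually.of_forall fun n => Eventually.of_forall fun ω => ?_))
  rw [sub_add_cancel]

theorem IsLittleOP.mul_sub_mul {X Y : ∀ n, Ω n → ℝ} {x y : ℕ → ℝ} {B : ℝ}
    (hX : IsLittleOP P fun n ω => X n ω - x n) (hY : IsLittleOP P fun n ω => Y n ω - y n)
    (hx : ∀ᶠ n in atTop, |x n| ≤ B) (hy : ∀ᶠ n in atTop, |y n| ≤ B) :
    IsLittleOP P fun n ω => X n ω * Y n ω - x n * y n := by
  have h := ((hX.isBoundedOP_of_sub hx).mul_isLittleOP hY).add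
    ((IsBoundedOP.of_bounded hy).mul_isLittleOP hX)
  refine h.congr (HighProb.of_eventually (Eventually.of_forall fun n =>
    Eventually.of_forall fun ω => ?_))
  ring

variable {x z : ℕ → ℝ} {c B : ℝ}

theorem eventually_abs_inv_le (hc : 0 < c) (hx : ∀ᶠ n in atTop, c ≤ x n) :
    ∀ᶠ n in atTop, |(x n)⁻¹| ≤ c⁻¹ := by
  filter_upwards [hx] with n hn
  rw [abs_of_pos (inv_pos.2 (hc.trans_le hn))]
  exact inv_anti₀ hc hn

theorem eventually_abs_le (hc : 0 < c) (hx : ∀ᶠ n in atTop, c ≤ x n ∧ x n ≤ B) :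
    ∀ᶠ n in atTop, |x n| ≤ B := by
  filter_upwards [hx] with n hn
  rw [abs_of_pos (hc.trans_le hn.1)]
  exact hn.2

theorem IsLittleOP.inv_sqrt {X : ∀ n, Ω n → ℝ} (hc : 0 < c) (hx : ∀ᶠ n in atTop, c ≤ x n)
    (hX : IsLittleOP P fun n ω => X n ω - x n) :
    IsLittleOP P fun n ω => (√(X n ω))⁻¹ - (√(x n))⁻¹ :=
  IsLittleOP.inv (Real.sqrt_pos.2 hc) (hx.mono fun _ h => Real.sqrt_le_sqrt h) (hX.sqrt hc hx)

/-- Estimating the coefficient costs n⁻¹A²/D, where A²/D is O_p(1) because D stays near numbers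
bounded away from zero. -/
theorem residual_variance_sub_isLittleOP {D A Q V : ∀ n, Ω n → ℝ} (hc : 0 < c)
    (hx : ∀ᶠ n in atTop, c ≤ x n ∧ x n ≤ B)
    (hD : IsLittleOP P fun n ω => D n ω - x n) (hA : IsBoundedOP P A)
    (hQ : IsLittleOP P fun n ω => Q n ω - z n)
    (hV : HighProb P fun n ω => V n ω = Q n ω - (n : ℝ)⁻¹ * (A n ω ^ 2 / D n ω)) :
    IsLittleOP P fun n ω => V n ω - z n := by
  have hDinv := (hD.inv hc (hx.mono fun _ h => h.1)).isBoundedOP_of_sub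
    (eventually_abs_inv_le hc (hx.mono fun _ h => h.1))
  have h1 := ((hA.mul hA).mul hDinv).mul_isLittleOP
    (IsLittleOP.of_tendsto (P := P) (tendsto_inv_atTop_nhds_zero_nat (𝕜 := ℝ)))
  refine (hQ.sub h1).congr (hV.imp fun n ω hω => ?_)
  rw [hω]
  ring

theorem variance_ratio_sub_isLittleOP {D V : ∀ n, Ω n → ℝ} (hc : 0 < c)
    (hx : ∀ᶠ n in atTop, c ≤ x n ∧ x n ≤ B) (hz : ∀ᶠ n in atTop, c ≤ z n ∧ z n ≤ B)
    (hD : IsLittleOP P fun n ω => D n ω - x n) (hV : IsLittleOP P fun n ω => V n ω - z n) :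
    IsLittleOP P fun n ω => V n ω * (D n ω)⁻¹ - z n / x n := by
  have h := hV.mul_sub_mul (B := max B c⁻¹) (hD.inv hc (hx.mono fun _ h => h.1))
    ((eventually_abs_le hc hz).mono fun _ h => h.trans (le_max_left _ _))
    ((eventually_abs_inv_le hc (hx.mono fun _ h => h.1)).mono fun _ h =>
      h.trans (le_max_right _ _))
  simpa only [div_eq_mul_inv] using h

/-- Both inverse roots have the same centre (zx)^(-1/2), so they differ by o_p(1). The claim follows
from A·u - S·v = u(A - S) + S(u - v). -/
theorem studentized_sub_isLittleOP {D V A S e : ∀ n, Ω n → ℝ} (hc : 0 < c)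
    (hx : ∀ᶠ n in atTop, c ≤ x n ∧ x n ≤ B) (hz : ∀ᶠ n in atTop, c ≤ z n ∧ z n ≤ B)
    (hD : IsLittleOP P fun n ω => D n ω - x n) (hV : IsLittleOP P fun n ω => V n ω - z n)
    (he : IsLittleOP P fun n ω => e n ω - z n) (hS : IsBoundedOP P S)
    (hAS : IsLittleOP P fun n ω => A n ω - S n ω) :
    IsLittleOP P fun n ω => A n ω * (√(V n ω * D n ω))⁻¹ - S n ω * (√(x n * e n ω))⁻¹ := by
  have hc2 : 0 < c * c := mul_pos hc hc
  have hzx : ∀ᶠ n in atTop, c * c ≤ z n * x n := by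
    filter_upwards [hx, hz] with n h1 h2
    exact mul_le_mul h2.1 h1.1 hc.le (hc.le.trans h2.1)
  have hxx : IsLittleOP P fun n (_ : Ω n) => x n - x n := by
    simpa only [sub_self] using IsLittleOP.of_tendsto (P := P) tendsto_const_nhds
  have h1 := (hV.mul_sub_mul hD (eventually_abs_le hc hz) (eventually_abs_le hc hx)).inv_sqrt
    hc2 hzx
  have h2 := (hxx.mul_sub_mul he (eventually_abs_le hc hx) (eventually_abs_le hc hz)).inv_sqrt
    hc2 (hzx.mono fun n h => by rwa [mul_comm (x n)])
  have hb := h1.isBoundedOP_of_sub (eventually_abs_inv_le (Real.sqrt_pos.2 hc2)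
    (hzx.mono fun _ h => Real.sqrt_le_sqrt h))
  refine ((hb.mul_isLittleOP hAS).add (hS.mul_isLittleOP (h1.sub h2))).congr
    (HighProb.of_eventually (Eventually.of_forall fun n => Eventually.of_forall fun ω => ?_))
  rw [mul_comm (x n) (z n)]
  ring

theorem studentized_eq {N A D V : ℝ} (hN : 0 < N) (hD : 0 < D) :
    A / D / √(V * D⁻¹) = (√N)⁻¹ * A * (√(V * (N⁻¹ * D)))⁻¹ := by
  have hsN : √N ≠ 0 := (Real.sqrt_pos.2 hN).ne'
  have hsD : √D ≠ 0 := (Real.sqrt_pos.2 hD).ne'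
  have hD2 : D = √D * √D := (Real.mul_self_sqrt hD.le).symm
  rw [Real.sqrt_mul' _ (inv_pos.2 hD).le, Real.sqrt_mul' _ (by positivity),
    Real.sqrt_mul (inv_pos.2 hN).le, Real.sqrt_inv, Real.sqrt_inv]
  -- No sign of V is assumed; when its root vanishes, division by zero makes both sides zero.
  rcases eq_or_ne (√V) 0 with h | h
  · simp [h]
  · nth_rewrite 1 [hD2]
    field_simp

end Studentization

/-! ### Measurability of the estimators -/

section Measurability

variable {Ω : Type*} [MeasurableSpace Ω]

/-- The inverse is det⁻¹ times the adjugate, both built from polynomials in the entries; the zero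
convention makes this valid for singular matrices too. -/
theorem measurable_matrix_inv_apply {κ : Type*} [Fintype κ] [DecidableEq κ]
    {M : Ω → Matrix κ κ ℝ} (hM : ∀ i j, Measurable fun ω => M ω i j) (i j : κ) :
    Measurable fun ω => (M ω)⁻¹ i j := by
  have hf : Measurable fun ω => (fun i j => M ω i j : κ → κ → ℝ) :=
    measurable_pi_lambda _ fun i => measurable_pi_lambda _ fun j => hM i j
  have hid : Continuous fun A : κ → κ → ℝ => Matrix.of A := continuous_id
  have hdet : Continuous fun A : κ → κ → ℝ => (Matrix.of A).det := hid.matrix_det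
  have hadj : Continuous fun A : κ → κ → ℝ => (Matrix.of A).adjugate i j :=
    hid.matrix_adjugate.matrix_elem i j
  have heq : (fun ω => (M ω)⁻¹ i j) = fun ω =>
      (Matrix.of fun i j => M ω i j).det⁻¹ * (Matrix.of fun i j => M ω i j).adjugate i j := by
    ext ω
    rw [Matrix.inv_def, Ring.inverse_eq_inv']
    rfl
  rw [heq]
  exact (hdet.measurable.comp hf).inv.mul (hadj.measurable.comp hf)

variable {n p : ℕ} {d : Fin n → Ω → ℝ} {w : Fin n → Ω → EuclideanSpace ℝ (Fin p)}
  {y : Fin n → Ω → ℝ}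

theorem measurable_designMatrix_apply (hd : ∀ i, Measurable (d i)) (hw : ∀ i, Measurable (w i))
    (i : Fin n) (k : Unit ⊕ Fin p) :
    Measurable fun ω => designMatrix (fun i => d i ω) (fun i => w i ω) i k := by
  rcases k with k | k
  · simpa [designMatrix] using hd i
  · have := hw i
    simp only [designMatrix, controlMatrix, Matrix.fromCols_apply_inr, Matrix.of_apply]
    fun_prop

theorem measurable_gram_apply {κ : Type*} {X : Ω → Matrix (Fin n) κ ℝ}
    (hX : ∀ i k, Measurable fun ω => X ω i k) (j k : κ) :
    Measurable fun ω => ((X ω)ᵀ * X ω) j k := by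
  simp only [Matrix.mul_apply, Matrix.transpose_apply]
  exact Finset.measurable_sum _ fun i _ => (hX i j).mul (hX i k)

theorem measurable_thetaHat (hd : ∀ i, Measurable (d i)) (hw : ∀ i, Measurable (w i))
    (hy : ∀ i, Measurable (y i)) (k : Unit ⊕ Fin p) :
    Measurable fun ω => thetaHat (fun i => d i ω) (fun i => w i ω) (fun i => y i ω) k := by
  have hX := measurable_designMatrix_apply hd hw
  simp only [thetaHat, Matrix.mulVec, dotProduct, Matrix.transpose_apply]
  exact Finset.measurable_sum _ fun j _ =>
    (measurable_matrix_inv_apply (measurable_gram_apply hX) k j).mul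
      (Finset.measurable_sum _ fun i _ => (hX i j).mul (hy i))

theorem measurable_sSq (hd : ∀ i, Measurable (d i)) (hw : ∀ i, Measurable (w i))
    (hy : ∀ i, Measurable (y i)) :
    Measurable fun ω => sSq (fun i => d i ω) (fun i => w i ω) (fun i => y i ω) := by
  have hθ := measurable_thetaHat hd hw hy
  have hw' : ∀ i k, Measurable fun ω => w i ω k := fun i k => by
    have := hw i
    fun_prop
  have hr : ∀ i, Measurable fun ω =>
      residual (fun i => d i ω) (fun i => w i ω) (fun i => y i ω) i := by
    intro i
    simp only [residual, betaHat, gammaHat, controlMatrix, Pi.sub_apply, Pi.smul_apply,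
      smul_eq_mul, Matrix.mulVec, dotProduct, Matrix.of_apply]
    exact ((hy i).sub ((hθ _).mul (hd i))).sub
      (Finset.measurable_sum _ fun j _ => (hw' i j).mul (hθ _))
  simp only [sSq, dotProduct]
  exact (Finset.measurable_sum _ fun i _ => (hr i).mul (hr i)).const_mul _

theorem measurable_dBreve (hd : ∀ i, Measurable (d i)) (hw : ∀ i, Measurable (w i)) (i : Fin n) :
    Measurable fun ω => dBreve (fun i => d i ω) (fun i => w i ω) i := by
  have hW : ∀ i k, Measurable fun ω => controlMatrix (fun i => w i ω) i k := fun i k => by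
    have := hw i
    simp only [controlMatrix, Matrix.of_apply]
    fun_prop
  simp only [dBreve, residualMaker, Matrix.mulVec, dotProduct, Matrix.sub_apply, Matrix.mul_apply,
    Matrix.transpose_apply (controlMatrix _)]
  refine Finset.measurable_sum _ fun j _ => (measurable_const.sub ?_).mul (hd j)
  refine Finset.measurable_sum _ fun k _ => (Finset.measurable_sum _ fun l _ => ?_).mul (hW j k)
  exact (hW i l).mul (measurable_matrix_inv_apply (measurable_gram_apply hW) l k)

theorem measurable_varBreve (hd : ∀ i, Measurable (d i)) (hw : ∀ i, Measurable (w i))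
    (hy : ∀ i, Measurable (y i)) :
    Measurable fun ω => varBreve (fun i => d i ω) (fun i => w i ω) (fun i => y i ω) := by
  have hD := measurable_dBreve hd hw
  simp only [varBreve, dotProduct]
  exact (measurable_sSq hd hw hy).mul (Finset.measurable_sum _ fun i _ => (hD i).mul (hD i)).inv

theorem measurable_varTextbook (hd : ∀ i, Measurable (d i)) (hw : ∀ i, Measurable (w i))
    (hy : ∀ i, Measurable (y i)) :
    Measurable fun ω => varTextbook (fun i => d i ω) (fun i => w i ω) (fun i => y i ω) := by
  simp only [varTextbook, Matrix.smul_apply, smul_eq_mul]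
  exact (measurable_sSq hd hw hy).mul (measurable_matrix_inv_apply
    (measurable_gram_apply (measurable_designMatrix_apply hd hw)) _ _)

end Measurability

end OLSArray

namespace OLSArray

/-! ### Effect of the projection on bilinear forms -/

section GramBound

variable {n p : ℕ} {w : Fin n → EuclideanSpace ℝ (Fin p)} {κ : ℝ}

theorem dotProduct_self_nonneg' {ι : Type*} [Fintype ι] (z : ι → ℝ) : 0 ≤ z ⬝ᵥ z :=
  Finset.sum_nonneg fun _ _ => mul_self_nonneg _

theorem isUnit_det_of_mul_le {A : Matrix (Fin p) (Fin p) ℝ} (hκ : 0 < κ)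
    (hA : ∀ z : Fin p → ℝ, κ * (z ⬝ᵥ z) ≤ z ⬝ᵥ (A *ᵥ z)) : IsUnit A.det := by
  rw [← Matrix.isUnit_iff_isUnit_det, ← Matrix.mulVec_injective_iff_isUnit]
  refine (injective_iff_map_eq_zero A.mulVecLin).2 fun z hz => ?_
  have h := hA z
  rw [Matrix.mulVecLin_apply] at hz
  rw [hz, dotProduct_zero] at h
  exact dotProduct_self_eq_zero.1 (le_antisymm (by nlinarith) (dotProduct_self_nonneg' z))

theorem gram_mul_le (hn : 1 ≤ n) (hw : ∀ z : Fin p → ℝ, κ * (z ⬝ᵥ z) ≤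
      z ⬝ᵥ (((n : ℝ)⁻¹ • ((controlMatrix w)ᵀ * controlMatrix w)) *ᵥ z)) (z : Fin p → ℝ) :
    (n * κ) * (z ⬝ᵥ z) ≤ z ⬝ᵥ (((controlMatrix w)ᵀ * controlMatrix w) *ᵥ z) := by
  have hn0 : (0 : ℝ) < n := by exact_mod_cast hn
  have h := hw z
  rw [Matrix.smul_mulVec, dotProduct_smul, smul_eq_mul, ← div_eq_inv_mul, le_div_iff₀ hn0] at h
  linarith

/-- The error of replacing M by the identity is a form in Wᵀu and Wᵀv with matrix (WᵀW)⁻¹. This one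
bound serves for CᵀMC, CᵀMε and εᵀMε. -/
theorem abs_dotProduct_residualMaker_sub_le (hn : 1 ≤ n) (hκ : 0 < κ)
    (hw : ∀ z : Fin p → ℝ, κ * (z ⬝ᵥ z) ≤
      z ⬝ᵥ (((n : ℝ)⁻¹ • ((controlMatrix w)ᵀ * controlMatrix w)) *ᵥ z)) (u v : Fin n → ℝ) :
    |u ⬝ᵥ (residualMaker w *ᵥ v) - u ⬝ᵥ v| ≤ (n * κ)⁻¹ *
      (√(((controlMatrix w)ᵀ *ᵥ u) ⬝ᵥ ((controlMatrix w)ᵀ *ᵥ u)) *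
        √(((controlMatrix w)ᵀ *ᵥ v) ⬝ᵥ ((controlMatrix w)ᵀ *ᵥ v))) := by
  have hn0 : (0 : ℝ) < n := by exact_mod_cast hn
  have hg := gram_mul_le hn hw
  rw [dotProduct_residualMaker, sub_sub_cancel_left, abs_neg]
  exact abs_dotProduct_inv_mulVec_le (mul_pos hn0 hκ)
    (isUnit_det_of_mul_le (mul_pos hn0 hκ) hg) hg _ _

theorem sqrt_dotProduct_controlMatrix_div (w : Fin n → EuclideanSpace ℝ (Fin p))
    (e : Fin n → ℝ) :
    (n : ℝ)⁻¹ * √(((controlMatrix w)ᵀ *ᵥ e) ⬝ᵥ ((controlMatrix w)ᵀ *ᵥ e)) =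
      ‖(n : ℝ)⁻¹ • ∑ i, e i • w i‖ := by
  rw [norm_smul, Real.norm_of_nonneg (by positivity), EuclideanSpace.norm_eq]
  congr 2
  simp only [dotProduct, Matrix.mulVec, Matrix.transpose_apply, controlMatrix, Matrix.of_apply]
  refine Finset.sum_congr rfl fun j _ => ?_
  rw [Real.norm_eq_abs, sq_abs, sq]
  simp [mul_comm]

end GramBound

/-! ### Stochastic boundedness of weighted sums -/

section ArrayBounds

variable {Ω : ℕ → Type*} [∀ n, MeasurableSpace (Ω n)] {P : ∀ n, Measure (Ω n)}
  [∀ n, IsProbabilityMeasure (P n)] {d : ∀ n, Fin n → Ω n → ℝ} {μ s : ℕ → ℝ} {B L : ℝ}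

/-- Cross terms vanish, so each squared sum has mean at most nBL. One index `k` covers Cᵀε; one
index per control covers WᵀC. -/
theorem isBoundedOP_sum_sq {ι : Type*} [Fintype ι] {x : ι → ∀ n, Fin n → Ω n → ℝ}
    (hd : ∀ n i, MemLp (d n i) 2 (P n)) (hdm : ∀ n i, Measurable (d n i))
    (hx : ∀ k n i, MemLp (x k n i) 2 (P n)) (hxm : ∀ k n i, Measurable (x k n i))
    (hmean : ∀ n i, ∫ ω, d n i ω ∂(P n) = μ n) (hvar : ∀ n i, variance (d n i) (P n) = s n)
    (hind : ∀ n, iIndepFun (d n) (P n))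
    (hdx : ∀ k n, IndepFun (fun ω i => d n i ω) (fun ω i => x k n i ω) (P n))
    (hs : ∀ n, 1 ≤ n → 0 ≤ s n ∧ s n ≤ B)
    (hxL : ∀ k n i, ∫ ω, x k n i ω ^ 2 ∂(P n) ≤ L) :
    IsBoundedOP P fun n ω => (n : ℝ)⁻¹ * ∑ k, (∑ i, (d n i ω - μ n) * x k n i ω) ^ 2 := by
  refine IsBoundedOP.of_lintegral_le (C := Fintype.card ι * (B * L)) (fun n => ?_) ?_
  · have := hdm n
    have := fun k => hxm k n
    exact (by fun_prop : Measurable _).aemeasurable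
  filter_upwards [eventually_ge_atTop 1] with n hn
  have hn0 : (0 : ℝ) < n := by exact_mod_cast hn
  have h := fun k => integral_sq_sum_centered (hd n) (hdm n) (hx k n) (hmean n) (hvar n) (hind n)
    (hdx k n)
  refine lintegral_enorm_le_of_integral_le
    ((integrable_finsetSum _ fun k _ => (h k).1).const_mul _) (fun ω => by positivity) ?_
  rw [integral_const_mul, integral_finsetSum _ fun k _ => (h k).1, inv_mul_le_iff₀ hn0]
  calc ∑ k, ∫ ω, (∑ i, (d n i ω - μ n) * x k n i ω) ^ 2 ∂(P n) ≤ ∑ _k : ι, B * (n * L) := by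
        refine Finset.sum_le_sum fun k _ => ?_
        rw [(h k).2]
        refine mul_le_mul (hs n hn).2 ?_ (Finset.sum_nonneg fun i _ =>
          integral_nonneg fun ω => sq_nonneg _) ((hs n hn).1.trans (hs n hn).2)
        calc ∑ i, ∫ ω, x k n i ω ^ 2 ∂(P n) ≤ ∑ _i : Fin n, L :=
              Finset.sum_le_sum fun i _ => hxL k n i
          _ = n * L := by simp
    _ = n * (Fintype.card ι * (B * L)) := by
        rw [Finset.sum_const, Finset.card_univ, nsmul_eq_mul]
        ring

end ArrayBounds

end OLSArray

/-! ### The main theorem -/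

theorem corollary1
    {Ω : ℕ → Type*} [∀ n, MeasurableSpace (Ω n)]
    (P : ∀ n, Measure (Ω n)) [∀ n, IsProbabilityMeasure (P n)]
    -- the number of controls is `q + 1`; the control with index `0` is the intercept
    (q : ℕ)
    (d : ∀ n, Fin n → Ω n → ℝ)
    (w : ∀ n, Fin n → Ω n → EuclideanSpace ℝ (Fin (q + 1)))
    (ε : ∀ n, Fin n → Ω n → ℝ)
    (y : ∀ n, Fin n → Ω n → ℝ)
    (β : ℕ → ℝ) (γ : ℕ → EuclideanSpace ℝ (Fin (q + 1)))
    (μd σd2 : ℕ → ℝ) (K δ₁ δ₂ : ℝ)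
    (hK : 0 < K) (hδ₁ : 0 < δ₁) (hδ₂ : 0 < δ₂)
    (hd_meas : ∀ n i, Measurable (d n i))
    (hw_meas : ∀ n i, Measurable (w n i))
    (hε_meas : ∀ n i, Measurable (ε n i))
    -- the regression model, with mean zero errors
    (hmodel : ∀ n i ω, y n i ω = d n i ω * β n + inner ℝ (w n i ω) (γ n) + ε n i ω)
    (hε_mean : ∀ n i, ∫ ω, ε n i ω ∂(P n) = 0)
    -- the regressor of interest
    (hd_indep : ∀ n, iIndepFun (d n) (P n))
    (hd_ident : ∀ n i j, IdentDistrib (d n i) (d n j) (P n) (P n))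
    (hd_mean : ∀ n i, ∫ ω, d n i ω ∂(P n) = μd n)
    (hd_var : ∀ n i, variance (d n i) (P n) = σd2 n)
    (hdw : ∀ n, IndepFun (fun ω i => d n i ω) (fun ω i => w n i ω) (P n))
    (hd_mom : ∀ n i, ∫⁻ ω, ‖d n i ω‖ₑ ^ (2 + δ₁) ∂(P n) ≤ ENNReal.ofReal K)
    (hσd2 : ∀ n, 1 ≤ n → K⁻¹ ≤ σd2 n)
    (hdε : ∀ n, IndepFun (fun ω i => d n i ω) (fun ω i => ε n i ω) (P n))
    -- the controls
    (hw_eig : ∃ R : ∀ n, Ω n → ℝ, OLSArray.IsLittleOP P R ∧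
      ∀ n, 1 ≤ n → ∀ᵐ ω ∂(P n), K⁻¹ + R n ω ≤
        OLSArray.lambdaMin ((n : ℝ)⁻¹ • ((OLSArray.controlMatrix fun i => w n i ω)ᵀ *
          OLSArray.controlMatrix fun i => w n i ω)))
    (hw_mom : ∀ n i, ∫⁻ ω, ‖w n i ω‖ₑ ^ 2 ∂(P n) ≤ ENNReal.ofReal K)
    (hw_const : ∀ n, ∃ c : ℝ, c ≠ 0 ∧ ∀ i, ∀ᵐ ω ∂(P n), w n i ω 0 = c)
    -- the errors
    (hwε : OLSArray.IsLittleOP P fun n ω => ‖(n : ℝ)⁻¹ • ∑ i, ε n i ω • w n i ω‖)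
    (hε_lln : OLSArray.IsLittleOP P fun n ω =>
      (n : ℝ)⁻¹ * ∑ i, ε n i ω ^ 2 - (n : ℝ)⁻¹ * ∑ i, ∫ ω', ε n i ω' ^ 2 ∂(P n))
    (hε_mom : ∀ n i, ∫⁻ ω, ‖ε n i ω‖ₑ ^ (2 + δ₂) ∂(P n) ≤ ENNReal.ofReal K)
    (hε_var : ∀ n : ℕ, 1 ≤ n → K⁻¹ ≤ (n : ℝ)⁻¹ * ∑ i, ∫ ω, ε n i ω ^ 2 ∂(P n)) :
    -- consistency of the variance estimate
    (OLSArray.IsLittleOP P fun n ω =>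
      OLSArray.sSq (fun i => d n i ω) (fun i => w n i ω) (fun i => y n i ω) *
          ((n : ℝ)⁻¹ * (OLSArray.dBreve (fun i => d n i ω) (fun i => w n i ω) ⬝ᵥ
            OLSArray.dBreve (fun i => d n i ω) (fun i => w n i ω)))⁻¹ -
        ((n : ℝ)⁻¹ * ∑ i, variance (ε n i) (P n)) / σd2 n) ∧
    -- asymptotic normality of the studentized statistic
    TendstoInDistribution
      (fun n ω =>
        (OLSArray.betaHat (fun i => d n i ω) (fun i => w n i ω) (fun i => y n i ω) - β n) /
          √(OLSArray.varBreve (fun i => d n i ω) (fun i => w n i ω) (fun i => y n i ω)))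
      atTop (id : ℝ → ℝ) P (gaussianReal 0 1) ∧
    -- the same two facts for the textbook variance formula
    (OLSArray.IsLittleOP P fun n ω =>
      (n : ℝ) * OLSArray.varTextbook (fun i => d n i ω) (fun i => w n i ω) (fun i => y n i ω) -
        ((n : ℝ)⁻¹ * ∑ i, variance (ε n i) (P n)) / σd2 n) ∧
    TendstoInDistribution
      (fun n ω =>
        (OLSArray.betaHat (fun i => d n i ω) (fun i => w n i ω) (fun i => y n i ω) - β n) /
          √(OLSArray.varTextbook (fun i => d n i ω) (fun i => w n i ω) (fun i => y n i ω)))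
      atTop (id : ℝ → ℝ) P (gaussianReal 0 1) := by
  -- A single exponent above 2 available to both the regressor and the errors, capped at 3 for the
  -- Taylor bound.
  set p : ℝ := 2 + min (min δ₁ δ₂) 1 with hp
  have hp2 : 2 < p := by
    have : 0 < min (min δ₁ δ₂) 1 := lt_min (lt_min hδ₁ hδ₂) one_pos
    linarith
  have hp3 : p ≤ 3 := by linarith [min_le_right (min δ₁ δ₂) 1]
  have hpd : p ≤ 2 + δ₁ := by linarith [min_le_left (min δ₁ δ₂) 1, min_le_left δ₁ δ₂]
  have hpε : p ≤ 2 + δ₂ := by linarith [min_le_left (min δ₁ δ₂) 1, min_le_right δ₁ δ₂]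
  have hy_meas : ∀ n i, Measurable (y n i) := by
    intro n i
    have h1 := hd_meas n i
    have h2 := hw_meas n i
    have h3 := hε_meas n i
    have : y n i = fun ω => d n i ω * β n + inner ℝ (w n i ω) (γ n) + ε n i ω :=
      funext (hmodel n i)
    rw [this]
    fun_prop
  have hKi : 0 < K⁻¹ := inv_pos.2 hK
  have hdL := fun n i => OLSArray.memLp_two_of_lintegral_le (P := P n) (hd_meas n i)
    (by linarith : 2 ≤ 2 + δ₁) hK.le (hd_mom n i)
  have hεL := fun n i => OLSArray.memLp_two_of_lintegral_le (P := P n) (hε_meas n i)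
    (by linarith : 2 ≤ 2 + δ₂) hK.le (hε_mom n i)
  have hwk_meas : ∀ (k : Fin (q + 1)) n i, Measurable fun ω => w n i ω k := fun k n i => by
    have := hw_meas n i
    fun_prop
  have hwL : ∀ (k : Fin (q + 1)) n i, MemLp (fun ω => w n i ω k) 2 (P n) ∧
      ∫ ω, w n i ω k ^ 2 ∂(P n) ≤ 1 + K := by
    intro k n i
    refine OLSArray.memLp_two_of_lintegral_le (hwk_meas k n i) le_rfl hK.le
      (le_trans (lintegral_mono fun ω => ?_) (hw_mom n i))
    simp only [ENNReal.rpow_ofNat]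
    gcongr
    rw [enorm_le_iff_norm_le]
    exact PiLp.norm_apply_le _ _
  have hσε : ∀ n : ℕ, (n : ℝ)⁻¹ * ∑ i, variance (ε n i) (P n) =
      (n : ℝ)⁻¹ * ∑ i, ∫ ω, ε n i ω ^ 2 ∂(P n) := by
    intro n
    congr 1
    refine Finset.sum_congr rfl fun i _ => ?_
    rw [variance_eq_integral (hε_meas n i).aemeasurable, hε_mean]
    simp only [sub_zero]
  simp only [hσε]
  set z : ℕ → ℝ := fun n => (n : ℝ)⁻¹ * ∑ i, ∫ ω, ε n i ω ^ 2 ∂(P n) with hz_def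
  have hs_le : ∀ n, 1 ≤ n → K⁻¹ ≤ σd2 n ∧ σd2 n ≤ 1 + K := by
    intro n hn
    refine ⟨hσd2 n hn, ?_⟩
    rw [← hd_var n ⟨0, hn⟩]
    exact (variance_le_expectation_sq (hd_meas n _).aestronglyMeasurable).trans (hdL n _).2
  have hz_le : ∀ n, 1 ≤ n → K⁻¹ ≤ z n ∧ z n ≤ 1 + K := by
    intro n hn
    have hn0 : (0 : ℝ) < n := by exact_mod_cast hn
    refine ⟨hε_var n hn, ?_⟩
    simp only [hz_def]
    rw [inv_mul_le_iff₀ hn0]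
    calc ∑ i, ∫ ω, ε n i ω ^ 2 ∂(P n) ≤ ∑ _i : Fin n, (1 + K) :=
          Finset.sum_le_sum fun i _ => (hεL n i).2
      _ = n * (1 + K) := by rw [Finset.sum_const, Finset.card_univ, Fintype.card_fin, nsmul_eq_mul]
  have hs_ev : ∀ᶠ n in atTop, K⁻¹ ≤ σd2 n ∧ σd2 n ≤ 1 + K :=
    (eventually_ge_atTop 1).mono hs_le
  have hz_ev : ∀ᶠ n in atTop, K⁻¹ ≤ z n ∧ z n ≤ 1 + K := (eventually_ge_atTop 1).mono hz_le
  -- the building blocks of the limit theory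
  let dc : ∀ n, Ω n → Fin n → ℝ := fun n ω i => d n i ω - μd n
  let e : ∀ n, Ω n → Fin n → ℝ := fun n ω i => ε n i ω
  let W : ∀ n, Ω n → Matrix (Fin n) (Fin (q + 1)) ℝ := fun n ω =>
    OLSArray.controlMatrix fun i => w n i ω
  let M : ∀ n, Ω n → Matrix (Fin n) (Fin n) ℝ := fun n ω =>
    OLSArray.residualMaker fun i => w n i ω
  -- The scalings differ: `a` = n^(-1/2)‖WᵀC‖ will be O_p(1), while `b` = n⁻¹‖Wᵀε‖ is o_p(1).
  let a : ∀ n, Ω n → ℝ := fun n ω => (√n)⁻¹ * √(((W n ω)ᵀ *ᵥ dc n ω) ⬝ᵥ ((W n ω)ᵀ *ᵥ dc n ω))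
  let b : ∀ n, Ω n → ℝ := fun n ω => (n : ℝ)⁻¹ * √(((W n ω)ᵀ *ᵥ e n ω) ⬝ᵥ ((W n ω)ᵀ *ᵥ e n ω))
  let S : ∀ n, Ω n → ℝ := fun n ω => (√n)⁻¹ * ∑ i, dc n ω i * ε n i ω
  let DD : ∀ n, Ω n → ℝ := fun n ω =>
    OLSArray.dBreve (fun i => d n i ω) (fun i => w n i ω) ⬝ᵥ
      OLSArray.dBreve (fun i => d n i ω) (fun i => w n i ω)
  let A : ∀ n, Ω n → ℝ := fun n ω => dc n ω ⬝ᵥ (M n ω *ᵥ e n ω)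
  let V : ∀ n, Ω n → ℝ := fun n ω =>
    OLSArray.sSq (fun i => d n i ω) (fun i => w n i ω) (fun i => y n i ω)
  have hv := OLSArray.isLittleOP_mean_sq_sub hK hp2 hpd hd_meas hd_indep hd_mean hd_var hd_mom
  have hs0 : ∀ n, 1 ≤ n → 0 ≤ σd2 n ∧ σd2 n ≤ 1 + K := fun n hn =>
    ⟨hKi.le.trans (hs_le n hn).1, (hs_le n hn).2⟩
  have hsq : ∀ n : ℕ, ((√n)⁻¹) ^ 2 = (n : ℝ)⁻¹ := fun n => by
    rw [inv_pow, Real.sq_sqrt (Nat.cast_nonneg n)]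
  have hS : OLSArray.IsBoundedOP P S := by
    have h := OLSArray.isBoundedOP_sum_sq (ι := Unit) (x := fun _ => ε) (fun n i => (hdL n i).1)
      hd_meas (fun _ n i => (hεL n i).1) (fun _ => hε_meas) hd_mean hd_var hd_indep (fun _ => hdε)
      hs0 (fun _ n i => (hεL n i).2)
    refine OLSArray.IsBoundedOP.of_sq ?_
    simpa only [S, dc, mul_pow, hsq, Finset.univ_unique, Finset.sum_singleton] using h
  have ha : OLSArray.IsBoundedOP P a := by
    have h := OLSArray.isBoundedOP_sum_sq (ι := Fin (q + 1)) (x := fun k n i ω => w n i ω k)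
      (fun n i => (hdL n i).1) hd_meas (fun k n i => (hwL k n i).1) hwk_meas hd_mean hd_var
      hd_indep (fun k n => (hdw n).comp (φ := id)
        (ψ := fun v : Fin n → EuclideanSpace ℝ (Fin (q + 1)) => fun i => v i k) measurable_id
        (measurable_pi_lambda _ fun i => by fun_prop))
      hs0 (fun k n i => (hwL k n i).2)
    refine OLSArray.IsBoundedOP.of_sq ?_
    have heq : ∀ n ω, a n ω ^ 2 =
        (n : ℝ)⁻¹ * ∑ k, (∑ i, (d n i ω - μd n) * w n i ω k) ^ 2 := by
      intro n ω
      simp only [a]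
      rw [mul_pow, hsq, Real.sq_sqrt (OLSArray.dotProduct_self_nonneg' _)]
      simp only [dotProduct, Matrix.mulVec, Matrix.transpose_apply, W, dc, OLSArray.controlMatrix,
        Matrix.of_apply, ← sq, mul_comm]
    simpa only [heq] using h
  have hb : OLSArray.IsLittleOP P b := by
    simpa only [b, W, e, OLSArray.sqrt_dotProduct_controlMatrix_div] using hwε
  -- on an event of probability tending to one the controls are well behaved
  set κ : ℝ := (2 * K)⁻¹ with hκ_def
  have hκ : 0 < κ := by positivity
  have hκK : κ = K⁻¹ / 2 := by
    rw [hκ_def, mul_inv]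
    ring
  have hgood : OLSArray.HighProb P fun n ω => 1 ≤ n ∧
      (∀ x : Fin (q + 1) → ℝ, κ * (x ⬝ᵥ x) ≤ x ⬝ᵥ (((n : ℝ)⁻¹ • ((W n ω)ᵀ * W n ω)) *ᵥ x)) ∧
      OLSArray.dBreve (fun i => d n i ω) (fun i => w n i ω) = M n ω *ᵥ dc n ω := by
    obtain ⟨R, hR, hRle⟩ := hw_eig
    refine (hR.highProb hκ).mono ?_
    filter_upwards [eventually_ge_atTop 1] with n hn
    obtain ⟨c, hc, hcw⟩ := hw_const n
    have hn0 : (0 : ℝ) < n := by exact_mod_cast hn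
    filter_upwards [hRle n hn, ae_all_iff.2 hcw] with ω h1 h2 h3
    have hH : ((n : ℝ)⁻¹ • ((W n ω)ᵀ * W n ω)).IsHermitian := by
      rw [Matrix.IsHermitian, Matrix.conjTranspose_eq_transpose_of_trivial, Matrix.transpose_smul,
        Matrix.transpose_mul, Matrix.transpose_transpose]
    have h4 : ∀ x : Fin (q + 1) → ℝ,
        κ * (x ⬝ᵥ x) ≤ x ⬝ᵥ (((n : ℝ)⁻¹ • ((W n ω)ᵀ * W n ω)) *ᵥ x) := fun x =>
      le_trans (mul_le_mul_of_nonneg_right (by linarith [(abs_lt.1 h3).1])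
        (OLSArray.dotProduct_self_nonneg' x)) (OLSArray.lambdaMin_mul_le hH x)
    refine ⟨hn, h4, ?_⟩
    have hu := OLSArray.isUnit_det_of_mul_le (mul_pos hn0 hκ) (OLSArray.gram_mul_le hn h4)
    exact (OLSArray.residualMaker_mulVec_sub_const hu hc h2 _ _).symm
  -- Projection changes the mean square of `C` by at most κ⁻¹a²/n.
  have hD : OLSArray.IsLittleOP P fun n ω => (n : ℝ)⁻¹ * DD n ω - σd2 n := by
    have h1 := (ha.mul ha).mul_isLittleOP
      ((OLSArray.IsLittleOP.of_tendsto (P := P)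
        (tendsto_inv_atTop_nhds_zero_nat (𝕜 := ℝ))).const_mul κ⁻¹)
    have h2 : OLSArray.IsLittleOP P fun n ω =>
        (n : ℝ)⁻¹ * DD n ω - (n : ℝ)⁻¹ * ∑ i, (d n i ω - μd n) ^ 2 := by
      refine h1.of_le (hgood.imp fun n ω ⟨hn, hW, hdB⟩ => ?_)
      have hn0 : (0 : ℝ) < n := by exact_mod_cast hn
      have hu := OLSArray.isUnit_det_of_mul_le (mul_pos hn0 hκ) (OLSArray.gram_mul_le hn hW)
      have h3 := OLSArray.abs_dotProduct_residualMaker_sub_le hn hκ hW (dc n ω) (dc n ω)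
      have h4 : DD n ω = dc n ω ⬝ᵥ (M n ω *ᵥ dc n ω) := by
        simp only [DD]
        rw [hdB]
        exact OLSArray.dBreve_dotProduct_dBreve hu (dc n ω)
      have h5 : ∑ i, (d n i ω - μd n) ^ 2 = dc n ω ⬝ᵥ dc n ω := by
        simp only [dotProduct, dc, sq]
      rw [h4, h5, ← mul_sub, abs_mul, abs_of_pos (inv_pos.2 hn0)]
      refine (mul_le_mul_of_nonneg_left h3 (inv_pos.2 hn0).le).trans (le_trans (le_of_eq ?_)
        (le_abs_self _))
      simp only [a]
      have h6 := hsq n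
      rw [mul_inv, ← h6]
      ring
    exact (h2.add hv).congr (OLSArray.HighProb.of_eventually (Eventually.of_forall fun n =>
      Eventually.of_forall fun ω => by ring))
  -- The error is at most κ⁻¹ab; boundedness of `a` comes from independence, smallness of `b` from
  -- the hypothesis on Wᵀε.
  have hAS : OLSArray.IsLittleOP P fun n ω => (√n)⁻¹ * A n ω - S n ω := by
    refine (ha.mul_isLittleOP (hb.const_mul κ⁻¹)).of_le (hgood.imp fun n ω ⟨hn, hW, _⟩ => ?_)
    have hn0 : (0 : ℝ) < n := by exact_mod_cast hn
    have h3 := OLSArray.abs_dotProduct_residualMaker_sub_le hn hκ hW (dc n ω) (e n ω)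
    have h5 : S n ω = (√n)⁻¹ * (dc n ω ⬝ᵥ e n ω) := rfl
    rw [h5, ← mul_sub, abs_mul, abs_of_nonneg (by positivity : 0 ≤ (√(n : ℝ))⁻¹)]
    refine (mul_le_mul_of_nonneg_left h3 (by positivity)).trans (le_trans (le_of_eq ?_)
      (le_abs_self _))
    simp only [a, b]
    rw [mul_inv]
    ring
  have hQ : OLSArray.IsLittleOP P fun n ω =>
      (n : ℝ)⁻¹ * (e n ω ⬝ᵥ (M n ω *ᵥ e n ω)) - z n := by
    have h2 : OLSArray.IsLittleOP P fun n ω =>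
        (n : ℝ)⁻¹ * (e n ω ⬝ᵥ (M n ω *ᵥ e n ω)) - (n : ℝ)⁻¹ * ∑ i, ε n i ω ^ 2 := by
      refine (hb.isBoundedOP.mul_isLittleOP (hb.const_mul κ⁻¹)).of_le
        (hgood.imp fun n ω ⟨hn, hW, _⟩ => ?_)
      have hn0 : (0 : ℝ) < n := by exact_mod_cast hn
      have h3 := OLSArray.abs_dotProduct_residualMaker_sub_le hn hκ hW (e n ω) (e n ω)
      have h5 : ∑ i, ε n i ω ^ 2 = e n ω ⬝ᵥ e n ω := by
        simp only [dotProduct, e, sq]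
      rw [h5, ← mul_sub, abs_mul, abs_of_pos (inv_pos.2 hn0)]
      refine (mul_le_mul_of_nonneg_left h3 (inv_pos.2 hn0).le).trans (le_trans (le_of_eq ?_)
        (le_abs_self _))
      simp only [b]
      rw [mul_inv]
      ring
    exact (h2.add hε_lln).congr (OLSArray.HighProb.of_eventually (Eventually.of_forall fun n =>
      Eventually.of_forall fun ω => by ring))
  have hA : OLSArray.IsBoundedOP P fun n ω => (√n)⁻¹ * A n ω := by
    refine (hAS.isBoundedOP.add hS).of_le (OLSArray.HighProb.of_eventually
      (Eventually.of_forall fun n => Eventually.of_forall fun ω => ?_))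
    rw [sub_add_cancel]
  -- the exact finite sample formulas on that event
  have hexact : OLSArray.HighProb P fun n ω => 1 ≤ n ∧ 0 < DD n ω ∧
      V n ω = (n : ℝ)⁻¹ * (e n ω ⬝ᵥ (M n ω *ᵥ e n ω) - A n ω ^ 2 / DD n ω) ∧
      OLSArray.betaHat (fun i => d n i ω) (fun i => w n i ω) (fun i => y n i ω) - β n =
        A n ω / DD n ω ∧
      OLSArray.varTextbook (fun i => d n i ω) (fun i => w n i ω) (fun i => y n i ω) =
        OLSArray.varBreve (fun i => d n i ω) (fun i => w n i ω) (fun i => y n i ω) := by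
    refine (hgood.and (hD.highProb hKi)).imp fun n ω ⟨⟨hn, hW, hdB⟩, hDn⟩ => ?_
    have hn0 : (0 : ℝ) < n := by exact_mod_cast hn
    have hu := OLSArray.isUnit_det_of_mul_le (mul_pos hn0 hκ) (OLSArray.gram_mul_le hn hW)
    -- The deviation is less than K⁻¹, which is a lower bound for the variance of the regressor.
    have hpos : 0 < (n : ℝ)⁻¹ * DD n ω := by linarith [(abs_lt.1 hDn).1, (hs_le n hn).1]
    have hDD : 0 < DD n ω := pos_of_mul_pos_right hpos (inv_pos.2 hn0).le
    -- `A` is built from the centred regressor; symmetry of M moves it onto the regressor, where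
    -- centring is invisible.
    have hAeq : (fun i => d n i ω) ⬝ᵥ (M n ω *ᵥ e n ω) = A n ω := by
      rw [← OLSArray.residualMaker_dotProduct]
      change OLSArray.dBreve (fun i => d n i ω) (fun i => w n i ω) ⬝ᵥ e n ω = A n ω
      rw [hdB]
      exact OLSArray.residualMaker_dotProduct _ _ _
    have hmod : ∀ i, y n i ω = d n i ω * β n + inner ℝ (w n i ω) (γ n) + e n ω i := fun i =>
      hmodel n i ω
    refine ⟨hn, hDD, ?_, ?_, OLSArray.varTextbook_eq_varBreve hu hDD.ne'⟩
    · rw [← hAeq]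
      exact OLSArray.sSq_eq hu hDD.ne' hmod
    · rw [← hAeq]
      exact OLSArray.betaHat_sub hu hDD.ne' hmod
  have hV : OLSArray.IsLittleOP P fun n ω => V n ω - z n := by
    refine OLSArray.residual_variance_sub_isLittleOP hKi hs_ev hD hA hQ
      (hexact.imp fun n ω ⟨hn, hDD, hVe, _⟩ => ?_)
    have hn0 : (0 : ℝ) < n := by exact_mod_cast hn
    rw [hVe, mul_pow, hsq, mul_div_mul_left _ _ (inv_pos.2 hn0).ne', mul_sub]
  have hratio := OLSArray.variance_ratio_sub_isLittleOP hKi hs_ev hz_ev hD hV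
  have hstud := OLSArray.studentized_sub_isLittleOP hKi hs_ev hz_ev hD hV hε_lln hS hAS
  -- The error normalization uses the realized Σε², which depends on `ε` alone and gives the weights
  -- unit norm.
  let Z : ∀ n, Ω n → ℝ := fun n ω =>
    ∑ i, ((d n i ω - μd n) / √(σd2 n)) * (ε n i ω / √(∑ j, ε n j ω ^ 2))
  have hlow : OLSArray.HighProb P fun n ω => (2 * K)⁻¹ ≤ (n : ℝ)⁻¹ * ∑ i, ε n i ω ^ 2 := by
    refine (hε_lln.highProb hκ).mono ?_
    filter_upwards [eventually_ge_atTop 1] with n hn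
    refine Eventually.of_forall fun ω hω => ?_
    have h1 := (hz_le n hn).1
    simp only [hz_def] at h1
    linarith [(abs_lt.1 hω).1]
  have hchar := OLSArray.tendsto_integral_exp_weighted_sum hK hp2 hp3 hpd hpε hd_meas hε_meas
    hd_indep hd_mean hd_var hσd2 hd_mom hdε hε_mom hlow
  have hZ_meas : ∀ n, Measurable (Z n) := fun n => by
    have := hd_meas n
    have := hε_meas n
    fun_prop
  have hT : OLSArray.IsLittleOP P fun n ω =>
      (OLSArray.betaHat (fun i => d n i ω) (fun i => w n i ω) (fun i => y n i ω) - β n) /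
        √(OLSArray.varBreve (fun i => d n i ω) (fun i => w n i ω) (fun i => y n i ω)) - Z n ω := by
    refine hstud.congr (hexact.imp fun n ω ⟨hn, hDD, _, hβ, _⟩ => ?_)
    have hn0 : (0 : ℝ) < n := by exact_mod_cast hn
    rw [hβ]
    congr 1
    · exact OLSArray.studentized_eq hn0 hDD
    · exact OLSArray.sum_div_mul_div_eq hn _ _ (hKi.le.trans (hs_le n hn).1)
  have hβ_meas : ∀ n, Measurable fun ω =>
      OLSArray.betaHat (fun i => d n i ω) (fun i => w n i ω) (fun i => y n i ω) - β n := fun n =>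
    (OLSArray.measurable_thetaHat (hd_meas n) (hw_meas n) (hy_meas n) _).sub_const _
  refine ⟨hratio, ?_, ?_, ?_⟩
  · exact OLSArray.tendstoInDistribution_gaussian_of_isLittleOP
      (fun n => (hβ_meas n).div
        (OLSArray.measurable_varBreve (hd_meas n) (hw_meas n) (hy_meas n)).sqrt)
      hZ_meas hT hchar
  · refine hratio.congr (hexact.imp fun n ω ⟨_, _, _, _, hvar⟩ => ?_)
    rw [hvar, OLSArray.varBreve, mul_inv, inv_inv]
    ring
  · refine OLSArray.tendstoInDistribution_gaussian_of_isLittleOP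
      (fun n => (hβ_meas n).div
        (OLSArray.measurable_varTextbook (hd_meas n) (hw_meas n) (hy_meas n)).sqrt)
      hZ_meas (hT.congr (hexact.imp fun n ω ⟨_, _, _, _, hvar⟩ => ?_)) hchar
    rw [hvar]
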